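/- Let $T,L>0$ and $\mathcal T=\{(y,z)\in\mathbb R^2: z\ge y\ge 0\}$. Functions in $H^1(0,L)$ are identified with their continuous representatives; a prime denotes the spatial derivative, a dot the time derivative, $a\vee b$ and $a\wedge b$ the maximum and minimum. Let $E_i,w_i\colon[0,1]\to\mathbb R$ $(i=1,2)$ and $\varphi\in C^0(\mathcal T)$, $\varphi\ge 0$. Put $\psi(z)=\varphi(z,z)$, $\bar\delta=\inf\{z>0:\psi\text{ is constant in }[z,+\infty)\}\in[0,+\infty]$ (with $\inf\emptyset=+\infty$) and $\mathcal T_{\bar\delta}=\{(y,z)\in\mathcal T: z<\bar\delta\}$. **Energies.** For $\boldsymbol u,\boldsymbol\alpha\in[H^1(0,L)]^2$ with $0\le\alpha_i\le1$ and continuous $\gamma\ge\delta\ge0$ on $[0,L]$ let $$\mathcal E[\boldsymbol u,\boldsymbol\alpha]=\sum_{i=1}^2\frac12\int_0^L E_i(\alpha_i)(u_i')^2\,dx,\quad \mathcal D[\boldsymbol\alpha]=\sum_{i=1}^2\Big(\frac12\int_0^L(\alpha_i')^2\,dx+\int_0^L w_i(\alpha_i)\,dx\Big),\quad \mathcal K[\delta,\gamma]=\int_0^L\varphi(\delta,\gamma)\,dx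 .$$ **Generalised energetic evolutions.** Let $\bar u\in AC([0,T])$ and let $u_i^0,\alpha_i^0\in H^1(0,L)$ satisfy $u_i^0(0)=0$, $u_i^0(L)=\bar u(0)$ and $0\le\alpha_i^0\le1$; put $\delta^0=|u_1^0-u_2^0|$. For $\boldsymbol u=(u_1,u_2)$ put $\delta(t,x)=|u_1(t,x)-u_2(t,x)|$, $\delta_h(t,x)=\sup_{\tau\in[0,t]}\delta(\tau,x)$. A triple $(\boldsymbol u,\boldsymbol\alpha,\gamma)\colon[0,T]\times[0,L]\to\mathbb R^2\times\mathbb R^2\times\mathbb R$ is a generalised energetic evolution if * for every $t\in[0,T]$ and $i=1,2$: $u_i(t),\alpha_i(t)\in H^1(0,L)$, $u_i(t,0)=0$, $u_i(t,L)=\bar u(t)$, $0\le\alpha_i(t)\le1$, and $\gamma(t)\in C^0([0,L])$; * $\boldsymbol u(0)=\boldsymbol u^0$, $\boldsymbol\alpha(0)=\boldsymbol\alpha^0$, $\gamma(0)=\delta^0$; * $\alpha_1(\cdot,x)$, $\alpha_2(\cdot,x)$ and $\gamma(\cdot,x)$ are non-decreasing on $[0,T]$ for every $x\in[0,L]$;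 * for every $t\in[0,T]$: $\gamma(t)\ge\delta(t)$ in $[0,L]$, and $$\mathcal E[\boldsymbol u(t),\boldsymbol\alpha(t)]+\mathcal D[\boldsymbol\alpha(t)]+\mathcal K[\delta(t),\gamma(t)]\le\mathcal E[\widetilde{\boldsymbol u},\widetilde{\boldsymbol\alpha}]+\mathcal D[\widetilde{\boldsymbol\alpha}]+\mathcal K[\widetilde\delta,\gamma(t)\vee\widetilde\delta],\qquad\widetilde\delta=|\widetilde u_1-\widetilde u_2|,$$ for all $\widetilde{\boldsymbol u},\widetilde{\boldsymbol\alpha}\in[H^1(0,L)]^2$ with $\widetilde u_i(0)=0$, $\widetilde u_i(L)=\bar u(t)$ and $\alpha_i(t)\le\widetilde\alpha_i\le1$ in $[0,L]$; * the function $\tau\mapsto\frac{\dot{\bar u}(\tau)}{L}\int_0^L\sum_{i=1}^2E_i(\alpha_i(\tau))u_i(\tau)'\,dx$ belongs to $L^1(0,T)$, and for every $t\in[0,T]$ $$\mathcal E[\boldsymbol u(t),\boldsymbol\alpha(t)]+\mathcal D[\boldsymbol\alpha(t)]+\mathcal K[\delta(t),\gamma(t)]=\mathcal E[\boldsymbol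 u^0,\boldsymbol\alpha^0]+\mathcal D[\boldsymbol\alpha^0]+\mathcal K[\delta^0,\delta^0]+\int_0^t\frac{\dot{\bar u}(\tau)}{L}\int_0^L\sum_{i=1}^2E_i(\alpha_i(\tau))u_i(\tau)'\,dx\,d\tau .$$ **Theorem (Equivalence between $\gamma$ and $\delta_h$).** Assume, for $i=1,2$: * $E_i\in C^2([0,1])$ is convex and $\frac12E_i''(y)E_i(y)-E_i'(y)^2>0$ for every $y\in[0,1]$; * $w_i\in C^1([0,1])$ is non-negative and, for some $\mu_i>0$, $w_i(\theta a+(1-\theta)b)\le\theta w_i(a)+(1-\theta)w_i(b)-\frac{\mu_i}2\theta(1-\theta)|a-b|^2$ for all $\theta,a,b\in[0,1]$; and assume: * ($\varphi$5) $\psi\in C^1([0,+\infty))$ is $\lambda$-convex for some $\lambda>0$: $\psi(\theta a+(1-\theta)b)\le\theta\psi(a)+(1-\theta)\psi(b)+\frac\lambda2\theta(1-\theta)|a-b|^2$ for all $\theta\in[0,1]$, $a,b\ge0$; * ($\varphi$6) for every $z>0$ the map $\varphi(\cdot,z)\in C^1([0,z])$ is non-decreasing and convex; * ($\varphi$7)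 for every $z>0$: $\partial_y\varphi(z,z)=\psi'(z)$ and $\partial_y\varphi(0,z)=0$; * ($\varphi$8) $\partial_y\varphi$ is continuous and bounded on $\mathcal T\setminus\{(0,0)\}$; * for every compact set $K\subseteq\{(y,z):z>y\ge0\}\cap\overline{\mathcal T_{\bar\delta}}$ there is $C_K>0$ such that $\varphi(y,z_2)-\varphi(y,z_1)\ge C_K(z_2-z_1)$ for all $(y,z_1),(y,z_2)\in K$ with $z_2\ge z_1$; * with $M_i=\max_{[0,1]}E_i''$ and $m_i=\min_{[0,1]}\big(\frac12E_i''E_i-(E_i')^2\big)$, for the $\lambda$ of ($\varphi$5), $$\frac{m_1}{M_1}\wedge\frac{m_2}{M_2}>\lambda\frac{L^2}{\pi^2}.$$ Then, for every generalised energetic evolution $(\boldsymbol u,\boldsymbol\alpha,\gamma)$ such that the family $\{\gamma(t)\wedge\bar\delta\}_{t\in[0,T]}$ is equicontinuous on $[0,L]$, one has $$\gamma(t,x)\wedge\bar\delta=\delta_h(t,x)\wedge\bar\delta\qquad\text{for every }(t,x)\in[0,T]\times[0,L].$$ -/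

import Mathlib

open Set MeasureTheory
open scoped ContDiff

noncomputable section

namespace CohesiveLaminate

/-! ### The Sobolev space `H¹(0,L)`

Functions of one space variable are total functions `ℝ → ℝ`; only their values on `[0,L]` are
ever used. -/

/-- `g` is a weak derivative of `f` on `(0,L)`. -/
def IsWeakDeriv (L : ℝ) (f g : ℝ → ℝ) : Prop :=
  ∀ η : ℝ → ℝ, ContDiff ℝ ∞ η → HasCompactSupport η → tsupport η ⊆ Ioo 0 L →
    ∫ x in (0 : ℝ)..L, f x * deriv η x = -∫ x in (0 : ℝ)..L, g x * η x

/-- `f` is (the continuous representative of) an element of `H¹(0,L)`. -/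
def MemH1 (L : ℝ) (f : ℝ → ℝ) : Prop :=
  ContinuousOn f (Icc 0 L) ∧
    ∃ g : ℝ → ℝ, MemLp g 2 (volume.restrict (Ioo 0 L)) ∧ IsWeakDeriv L f g

open Classical in
/-- The weak derivative of `f ∈ H¹(0,L)`, an `L²` function that is unique up to null sets
(and `0` if `f` has no weak derivative in `L²`). -/
def weakDeriv (L : ℝ) (f : ℝ → ℝ) : ℝ → ℝ :=
  if h : ∃ g : ℝ → ℝ, MemLp g 2 (volume.restrict (Ioo 0 L)) ∧ IsWeakDeriv L f g then
    Classical.choose h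
  else 0

/-- The set `H¹_{0,b}(0,L)` of the `H¹` functions `v` with `v(0) = 0` and `v(L) = b`. -/
def MemH1Bdry (L b : ℝ) (v : ℝ → ℝ) : Prop :=
  MemH1 L v ∧ v 0 = 0 ∧ v L = b

/-- The set `H¹_{[0,1]}(0,L)` of the `H¹` functions with values in `[0,1]`. -/
def MemH1Unit (L : ℝ) (v : ℝ → ℝ) : Prop :=
  MemH1 L v ∧ ∀ x ∈ Icc 0 L, v x ∈ Icc (0 : ℝ) 1

/-! ### Energies

The two layers are indexed by `Fin 2`; a pair of functions on `[0,L]` is a map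
`Fin 2 → ℝ → ℝ`, and a time dependent pair is a map `ℝ → Fin 2 → ℝ → ℝ`
(time, layer, position). -/

/-- The slip `|u₁ - u₂|`. -/
def slip (u : Fin 2 → ℝ → ℝ) (x : ℝ) : ℝ := |u 0 x - u 1 x|

/-- The history slip `δ_h(t,x) = sup_{τ ∈ [0,t]} |u₁(τ,x) - u₂(τ,x)|`. -/
def historySlip (u : ℝ → Fin 2 → ℝ → ℝ) (t x : ℝ) : ℝ :=
  sSup ((fun τ => slip (u τ) x) '' Icc 0 t)

/-- The stored elastic energy `ℰ[u,α]`. -/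
def elasticEnergy (L : ℝ) (E : Fin 2 → ℝ → ℝ) (u α : Fin 2 → ℝ → ℝ) : ℝ :=
  ∑ i, (1 / 2) * ∫ x in (0 : ℝ)..L, E i (α i x) * (weakDeriv L (u i) x) ^ 2

/-- The damage energy `𝒟[α]`. -/
def damageEnergy (L : ℝ) (w : Fin 2 → ℝ → ℝ) (α : Fin 2 → ℝ → ℝ) : ℝ :=
  ∑ i, ((1 / 2) * (∫ x in (0 : ℝ)..L, (weakDeriv L (α i) x) ^ 2)
    + ∫ x in (0 : ℝ)..L, w i (α i x))

/-- The cohesive energy `𝒦[δ,γ]`. -/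
def cohesiveEnergy (L : ℝ) (φ : ℝ → ℝ → ℝ) (δ γ : ℝ → ℝ) : ℝ :=
  ∫ x in (0 : ℝ)..L, φ (δ x) (γ x)

/-- The total energy `ℰ[u,α] + 𝒟[α] + 𝒦[|u₁ - u₂|,γ]`. -/
def totalEnergy (L : ℝ) (E w : Fin 2 → ℝ → ℝ) (φ : ℝ → ℝ → ℝ)
    (u α : Fin 2 → ℝ → ℝ) (γ : ℝ → ℝ) : ℝ :=
  elasticEnergy L E u α + damageEnergy L w α + cohesiveEnergy L φ (slip u) γ

/-- The stress `σ = E(α) u'` of a layer. -/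
def stress (L : ℝ) (e : ℝ → ℝ) (v a : ℝ → ℝ) (x : ℝ) : ℝ := e (a x) * weakDeriv L v x

/-- The power `(ū'(τ)/L) ∫₀ᴸ (σ₁ + σ₂)(τ,x) dx` of the prescribed displacement. -/
def power (L : ℝ) (E : Fin 2 → ℝ → ℝ) (ubar : ℝ → ℝ) (u α : ℝ → Fin 2 → ℝ → ℝ) (τ : ℝ) : ℝ :=
  deriv ubar τ / L * ∫ x in (0 : ℝ)..L, ∑ i, stress L (E i) (u τ i) (α τ i) x

/-- The work `𝒲[u,α](t)` of the prescribed displacement. -/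
def work (L : ℝ) (E : Fin 2 → ℝ → ℝ) (ubar : ℝ → ℝ) (u α : ℝ → Fin 2 → ℝ → ℝ) (t : ℝ) : ℝ :=
  ∫ τ in (0 : ℝ)..t, power L E ubar u α τ

/-! ### Generalised energetic evolutions -/

/-- Regularity and compatibility of the initial data. -/
structure CompatibleData (L : ℝ) (ubar : ℝ → ℝ) (u₀ α₀ : Fin 2 → ℝ → ℝ) : Prop where
  displacement : ∀ i, MemH1Bdry L (ubar 0) (u₀ i)
  damage : ∀ i, MemH1Unit L (α₀ i)

/-- `(u,α,γ)` is a generalised energetic evolution on `[0,T] × [0,L]` for the prescribed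
displacement `ubar` and the initial data `u₀`, `α₀`. -/
structure IsGeneralisedEnergeticEvolution (T L : ℝ) (E w : Fin 2 → ℝ → ℝ) (φ : ℝ → ℝ → ℝ)
    (ubar : ℝ → ℝ) (u₀ α₀ : Fin 2 → ℝ → ℝ)
    (u α : ℝ → Fin 2 → ℝ → ℝ) (γ : ℝ → ℝ → ℝ) : Prop where
  /-- compatibility -/
  displacement_mem : ∀ t ∈ Icc 0 T, ∀ i, MemH1Bdry L (ubar t) (u t i)
  damage_mem : ∀ t ∈ Icc 0 T, ∀ i, MemH1Unit L (α t i)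
  history_continuous : ∀ t ∈ Icc 0 T, ContinuousOn (γ t) (Icc 0 L)
  /-- initial data -/
  displacement_init : ∀ i, EqOn (u 0 i) (u₀ i) (Icc 0 L)
  damage_init : ∀ i, EqOn (α 0 i) (α₀ i) (Icc 0 L)
  history_init : EqOn (γ 0) (slip u₀) (Icc 0 L)
  /-- irreversibility -/
  damage_mono : ∀ i, ∀ s t, 0 ≤ s → s ≤ t → t ≤ T → ∀ x ∈ Icc 0 L, α s i x ≤ α t i x
  history_mono : ∀ s t, 0 ≤ s → s ≤ t → t ≤ T → ∀ x ∈ Icc 0 L, γ s x ≤ γ t x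
  /-- global stability -/
  slip_le_history : ∀ t ∈ Icc 0 T, ∀ x ∈ Icc 0 L, slip (u t) x ≤ γ t x
  globally_stable : ∀ t ∈ Icc 0 T, ∀ u' α' : Fin 2 → ℝ → ℝ,
    (∀ i, MemH1Bdry L (ubar t) (u' i)) →
    (∀ i, MemH1 L (α' i)) →
    (∀ i, ∀ x ∈ Icc 0 L, α t i x ≤ α' i x ∧ α' i x ≤ 1) →
    totalEnergy L E w φ (u t) (α t) (γ t)
      ≤ totalEnergy L E w φ u' α' (fun x => max (γ t x) (slip u' x))
  /-- energy balance -/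
  power_integrable : IntegrableOn (power L E ubar u α) (Ioo 0 T)
  energy_balance : ∀ t ∈ Icc 0 T,
    totalEnergy L E w φ (u t) (α t) (γ t)
      = totalEnergy L E w φ u₀ α₀ (slip u₀) + work L E ubar u α t

/-! ### Assumptions on the elastic moduli and on the dissipation densities -/

/-- The function `½ e'' e - (e')²` on `[0,1]` (one-sided derivatives at the end points). -/
def hardening (e : ℝ → ℝ) (y : ℝ) : ℝ :=
  (1 / 2) * iteratedDerivWithin 2 e (Icc 0 1) y * e y - (derivWithin e (Icc 0 1) y) ^ 2

/-- The convexity hypothesis on an elastic modulus. -/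
structure ModulusAssumption (e : ℝ → ℝ) : Prop where
  contDiffOn : ContDiffOn ℝ 2 e (Icc 0 1)
  convexOn : ConvexOn ℝ (Icc 0 1) e
  hardening_pos : ∀ y ∈ Icc (0 : ℝ) 1, 0 < hardening e y

/-- `M = max_{[0,1]} e''`. -/
def modulusM (e : ℝ → ℝ) : ℝ := sSup (iteratedDerivWithin 2 e (Icc 0 1) '' Icc 0 1)

/-- `m = min_{[0,1]} (½ e'' e - (e')²)`. -/
def modulusm (e : ℝ → ℝ) : ℝ := sInf (hardening e '' Icc 0 1)

/-- The convexity hypothesis on a dissipation density: `C¹([0,1])`, non-negative and uniformly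
convex. -/
structure DissipationAssumption (d : ℝ → ℝ) : Prop where
  contDiffOn : ContDiffOn ℝ 1 d (Icc 0 1)
  nonneg : ∀ y ∈ Icc (0 : ℝ) 1, 0 ≤ d y
  uniformlyConvex : ∃ μ : ℝ, 0 < μ ∧ StrongConvexOn (Icc 0 1) μ d

/-! ### Assumptions on the loading-unloading density -/

/-- The domain `𝒯 = {(y,z) : z ≥ y ≥ 0}` of the density. -/
def domT : Set (ℝ × ℝ) := {p | 0 ≤ p.1 ∧ p.1 ≤ p.2}

/-- The diagonal restriction `ψ(z) = φ(z,z)`. -/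
def diag (φ : ℝ → ℝ → ℝ) (z : ℝ) : ℝ := φ z z

/-- `δ̄ = inf {z > 0 : ψ is constant in [z,∞)}`, with `inf ∅ = +∞`. -/
def deltaBar (φ : ℝ → ℝ → ℝ) : EReal :=
  sInf ((fun z : ℝ => (z : EReal)) '' {z : ℝ | 0 < z ∧ ∀ s, z ≤ s → diag φ s = diag φ z})

/-- `a ∧ d` for a real `a` and an extended real `d` (used with `d ≥ 0`, so that the minimum is
a real number). -/
def cap (d : EReal) (a : ℝ) : ℝ := (min (a : EReal) d).toReal

/-- `𝒯_δ̄ = {(y,z) ∈ 𝒯 : z < δ̄}`. -/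
def domTBar (φ : ℝ → ℝ → ℝ) : Set (ℝ × ℝ) := {p | p ∈ domT ∧ (p.2 : EReal) < deltaBar φ}

/-- The partial derivative `∂_y φ(y,z)` of `φ(·,z)` in `[0,z]`. -/
def partialY (φ : ℝ → ℝ → ℝ) (y z : ℝ) : ℝ := derivWithin (fun s => φ s z) (Icc 0 z) y

/-- Continuity and non-negativity of `φ` on `𝒯` and the structural hypotheses, where `lam` is
the constant of `lam`-convexity of `ψ`. -/
structure DensityAssumption (φ : ℝ → ℝ → ℝ) (lam : ℝ) : Prop where
  continuousOn : ContinuousOn (fun p : ℝ × ℝ => φ p.1 p.2) domT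
  nonneg : ∀ p ∈ domT, 0 ≤ φ p.1 p.2
  /-- regularity and `lam`-convexity of `ψ` -/
  diag_contDiffOn : ContDiffOn ℝ 1 (diag φ) (Ici 0)
  diag_convex : ∀ θ ∈ Icc (0 : ℝ) 1, ∀ a ∈ Ici (0 : ℝ), ∀ b ∈ Ici (0 : ℝ),
    diag φ (θ * a + (1 - θ) * b)
      ≤ θ * diag φ a + (1 - θ) * diag φ b + lam / 2 * θ * (1 - θ) * |a - b| ^ 2
  /-- unloading regime: `φ(·,z)` is `C¹`, non-decreasing and convex -/
  contDiffOn_left : ∀ z : ℝ, 0 < z → ContDiffOn ℝ 1 (fun y => φ y z) (Icc 0 z)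
  monotoneOn_left : ∀ z : ℝ, 0 < z → MonotoneOn (fun y => φ y z) (Icc 0 z)
  convexOn_left : ∀ z : ℝ, 0 < z → ConvexOn ℝ (Icc 0 z) (fun y => φ y z)
  /-- compatibility of the loading and unloading regimes -/
  partialY_diag : ∀ z : ℝ, 0 < z → partialY φ z z = derivWithin (diag φ) (Ici 0) z
  partialY_zero : ∀ z : ℝ, 0 < z → partialY φ 0 z = 0
  /-- `∂_y φ` is continuous and bounded on `𝒯` minus the origin (where it is undefined) -/
  partialY_continuousOn : ContinuousOn (fun p : ℝ × ℝ => partialY φ p.1 p.2) (domT \ {(0, 0)})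
  partialY_bounded : ∃ C : ℝ, ∀ p ∈ domT \ {((0 : ℝ), (0 : ℝ))}, |partialY φ p.1 p.2| ≤ C

/-- Uniform strict monotonicity of `φ` with respect to the second variable. -/
def UniformStrictMono (φ : ℝ → ℝ → ℝ) : Prop :=
  ∀ K : Set (ℝ × ℝ), IsCompact K →
    K ⊆ {p : ℝ × ℝ | 0 ≤ p.1 ∧ p.1 < p.2} ∩ closure (domTBar φ) →
    ∃ C : ℝ, 0 < C ∧ ∀ y z₁ z₂ : ℝ, (y, z₁) ∈ K → (y, z₂) ∈ K → z₁ ≤ z₂ →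
      C * (z₂ - z₁) ≤ φ y z₂ - φ y z₁

end CohesiveLaminate

end

/-! The bound `historySlip ≤ γ` is immediate from `slip ≤ γ` and the monotonicity of `γ` in time.
The content is that, below `deltaBar`, `γ` cannot grow where the slip has not reached it: such
growth would cost cohesive energy at first order, and the energy balance leaves no room for it.

Uniform convexity comes first. With the history frozen, the total energy is uniformly convex in `(u,
α)`. A number `r` below both ratios `m_i / M_i` makes the compliances `(E_i - 2r)⁻¹` concave, so
each elastic density gains a multiple of the squared strain difference. The cohesive term is only
`lam`-convex in the signed slip, but its defect is absorbed through the sharp Poincaré constant `L²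
/ π²` as soon as `r > lam L² / π²`. Testing stability with midpoints then improves it by `κ *
stateDist` (`stable_add_le`).

Time increments are estimated next. The state at time `t`, with the same affine function subtracted
from both layers, is a competitor at time `s ≤ t`; its slip is unchanged. Combined with the energy
balance, improved stability bounds `cohesiveGap + κ * stateDist` by the work minus its frozen-stress
approximation, up to a quadratic error (`cohesiveGap_add_le`). With `A = ∫ |deriv ubar|` over `[s,
t]`, a first use gives `stateDist ≤ D A`, hence continuity of the total stress; a second use gives
`cohesiveGap ≤ C η A` whenever `A ≤ η²` (`exists_cohesiveGap_le`). The gaps along a fine partition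
therefore have arbitrarily small sum.

The contradiction is obtained in `not_historySlip_lt`. If `historySlip < min γ deltaBar` at `(t,
x)`, then on an interval near `x` the slip stays strictly below a level that `γ` must cross before
time `t`. Strict monotonicity of `φ` in its second argument bounds each gap below by the growth of a
truncated integral of `γ`; these bounds telescope to a fixed positive amount along every partition.
-/

namespace CohesiveLaminate

/-! ### Weak derivatives -/

/-- `f` is continuous on `[0,L]` and `g ∈ L²(0,L)` is a weak derivative of `f`. -/
structure HasH1Deriv (L : ℝ) (f g : ℝ → ℝ) : Prop where
  continuousOn : ContinuousOn f (Icc 0 L)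
  memLp : MemLp g 2 (volume.restrict (Ioo 0 L))
  isWeakDeriv : IsWeakDeriv L f g

lemma HasH1Deriv.memH1 {L : ℝ} {f g : ℝ → ℝ} (h : HasH1Deriv L f g) : MemH1 L f :=
  ⟨h.continuousOn, g, h.memLp, h.isWeakDeriv⟩

lemma MemH1.hasH1Deriv {L : ℝ} {f : ℝ → ℝ} (h : MemH1 L f) : HasH1Deriv L f (weakDeriv L f) := by
  have : weakDeriv L f = Classical.choose h.2 := by
    simp only [weakDeriv]; rw [dif_pos h.2]
  rw [this]
  exact ⟨h.1, (Classical.choose_spec h.2).1, (Classical.choose_spec h.2).2⟩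

lemma intervalIntegrable_mul_of_memLp_two {L : ℝ} (hL : 0 ≤ L) {f g : ℝ → ℝ}
    (hf : MemLp f 2 (volume.restrict (Ioo 0 L))) (hg : MemLp g 2 (volume.restrict (Ioo 0 L))) :
    IntervalIntegrable (fun x => f x * g x) volume 0 L := by
  rw [intervalIntegrable_iff_integrableOn_Ioo_of_le hL]
  exact hf.integrable_mul hg

lemma intervalIntegrable_sq_of_memLp_two {L : ℝ} (hL : 0 ≤ L) {f : ℝ → ℝ}
    (hf : MemLp f 2 (volume.restrict (Ioo 0 L))) :
    IntervalIntegrable (fun x => f x ^ 2) volume 0 L := by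
  simpa only [pow_two] using intervalIntegrable_mul_of_memLp_two hL hf hf

lemma intervalIntegrable_of_memLp_two {L : ℝ} (hL : 0 ≤ L) {f : ℝ → ℝ}
    (hf : MemLp f 2 (volume.restrict (Ioo 0 L))) : IntervalIntegrable f volume 0 L := by
  rw [intervalIntegrable_iff_integrableOn_Ioo_of_le hL]
  exact hf.integrable one_le_two

lemma integral_smul_eq_intervalIntegral {L : ℝ} (hL : 0 ≤ L) {F η : ℝ → ℝ}
    (hη : tsupport η ⊆ Ioo 0 L) : ∫ x, η x • F x = ∫ x in (0 : ℝ)..L, F x * η x := by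
  rw [intervalIntegral.integral_of_le hL, ← integral_indicator measurableSet_Ioc]
  refine integral_congr_ae (Filter.Eventually.of_forall fun x => ?_)
  by_cases hx : x ∈ Ioc 0 L
  · simp [indicator_of_mem hx, mul_comm]
  · have : η x = 0 := image_eq_zero_of_notMem_tsupport fun h => hx (Ioo_subset_Ioc_self (hη h))
    simp [indicator_of_notMem hx, this]

/-- Weak derivatives are unique up to null sets. -/
lemma IsWeakDeriv.ae_eq {L : ℝ} (hL : 0 ≤ L) {f g₁ g₂ : ℝ → ℝ}
    (h₁ : IsWeakDeriv L f g₁) (h₂ : IsWeakDeriv L f g₂)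
    (hg₁ : IntervalIntegrable g₁ volume 0 L) (hg₂ : IntervalIntegrable g₂ volume 0 L) :
    ∀ᵐ x, x ∈ Ioo 0 L → g₁ x = g₂ x := by
  have hi : IntegrableOn (fun x => g₁ x - g₂ x) (Ioo 0 L) := by
    rw [intervalIntegrable_iff_integrableOn_Ioo_of_le hL] at hg₁ hg₂
    exact hg₁.sub hg₂
  have := isOpen_Ioo.ae_eq_zero_of_integral_contDiff_smul_eq_zero hi.locallyIntegrableOn ?_
  · filter_upwards [this] with x hx hxL using sub_eq_zero.1 (hx hxL)
  intro η hη hc hs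
  rw [integral_smul_eq_intervalIntegral hL hs]
  have e₁ := h₁ η hη hc hs
  have e₂ := h₂ η hη hc hs
  simp only [sub_mul]
  rw [intervalIntegral.integral_sub (hg₁.mul_continuousOn hη.continuous.continuousOn)
    (hg₂.mul_continuousOn hη.continuous.continuousOn)]
  linarith

lemma HasH1Deriv.ae_eq {L : ℝ} (hL : 0 ≤ L) {f g₁ g₂ : ℝ → ℝ}
    (h₁ : HasH1Deriv L f g₁) (h₂ : HasH1Deriv L f g₂) : ∀ᵐ x, x ∈ Ioo 0 L → g₁ x = g₂ x :=
  h₁.isWeakDeriv.ae_eq hL h₂.isWeakDeriv (intervalIntegrable_of_memLp_two hL h₁.memLp)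
    (intervalIntegrable_of_memLp_two hL h₂.memLp)

lemma HasH1Deriv.linear_comb {L : ℝ} (hL : 0 ≤ L) {f₁ f₂ g₁ g₂ : ℝ → ℝ}
    (h₁ : HasH1Deriv L f₁ g₁) (h₂ : HasH1Deriv L f₂ g₂) (a b : ℝ) :
    HasH1Deriv L (fun x => a * f₁ x + b * f₂ x) (fun x => a * g₁ x + b * g₂ x) where
  continuousOn := (h₁.continuousOn.const_mul a).add (h₂.continuousOn.const_mul b)
  memLp := (h₁.memLp.const_mul a).add (h₂.memLp.const_mul b)
  isWeakDeriv := by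
    intro η hη hc hs
    have hη' : Continuous (deriv η) := hη.continuous_deriv (by simp)
    have c₁ : IntervalIntegrable (fun x => f₁ x * deriv η x) volume 0 L :=
      (h₁.continuousOn.mul hη'.continuousOn).intervalIntegrable_of_Icc hL
    have c₂ : IntervalIntegrable (fun x => f₂ x * deriv η x) volume 0 L :=
      (h₂.continuousOn.mul hη'.continuousOn).intervalIntegrable_of_Icc hL
    have d₁ : IntervalIntegrable (fun x => g₁ x * η x) volume 0 L :=
      (intervalIntegrable_of_memLp_two hL h₁.memLp).mul_continuousOn hη.continuous.continuousOn
    have d₂ : IntervalIntegrable (fun x => g₂ x * η x) volume 0 L :=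
      (intervalIntegrable_of_memLp_two hL h₂.memLp).mul_continuousOn hη.continuous.continuousOn
    have e₁ := h₁.isWeakDeriv η hη hc hs
    have e₂ := h₂.isWeakDeriv η hη hc hs
    simp only [add_mul, mul_assoc]
    rw [intervalIntegral.integral_add (c₁.const_mul a) (c₂.const_mul b),
      intervalIntegral.integral_add (d₁.const_mul a) (d₂.const_mul b),
      intervalIntegral.integral_const_mul, intervalIntegral.integral_const_mul,
      intervalIntegral.integral_const_mul, intervalIntegral.integral_const_mul, e₁, e₂]
    ring

/-! ### Primitives and the fundamental theorem of calculus. -/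

lemma ae_deriv_primitive_eq {L : ℝ} (hL : 0 ≤ L) {g : ℝ → ℝ}
    (hg : IntervalIntegrable g volume 0 L) :
    ∀ᵐ x, x ∈ Icc 0 L → deriv (fun x => ∫ t in (0 : ℝ)..x, g t) x = g x := by
  filter_upwards [hg.ae_hasDerivAt_integral] with x hx hxL
  rw [uIcc_of_le hL] at hx
  exact (hx hxL 0 ⟨le_rfl, hL⟩).deriv

lemma isWeakDeriv_primitive {L : ℝ} (hL : 0 ≤ L) {g : ℝ → ℝ}
    (hg : IntervalIntegrable g volume 0 L) :
    IsWeakDeriv L (fun x => ∫ t in (0 : ℝ)..x, g t) g := by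
  intro η hη hc hs
  have hF := hg.absolutelyContinuousOnInterval_intervalIntegral (c := 0) left_mem_uIcc
  have hηA : AbsolutelyContinuousOnInterval η 0 L :=
    (hη.of_le (by simp)).contDiffOn.absolutelyContinuousOnInterval
  have h0 : η 0 = 0 := image_eq_zero_of_notMem_tsupport fun h => lt_irrefl _ (hs h).1
  have h1 : η L = 0 := image_eq_zero_of_notMem_tsupport fun h => lt_irrefl _ (hs h).2
  rw [hF.integral_mul_deriv_eq_deriv_mul hηA, h0, h1]
  simp only [mul_zero, sub_zero, zero_sub]
  congr 1
  apply intervalIntegral.integral_congr_ae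
  filter_upwards [ae_deriv_primitive_eq hL hg] with x hx hxL
  rw [uIoc_of_le hL] at hxL
  rw [hx (Ioc_subset_Icc_self hxL)]

lemma exists_Icc_subset_of_isCompact {L : ℝ} (hL : 0 < L) {K : Set ℝ} (hK : IsCompact K)
    (hs : K ⊆ Ioo 0 L) : ∃ p q, 0 < p ∧ q < L ∧ K ⊆ Icc p q := by
  rcases K.eq_empty_or_nonempty with rfl | hne
  · exact ⟨L / 2, L / 2, by linarith, by linarith, empty_subset _⟩
  obtain ⟨p, hp⟩ := hK.exists_isLeast hne
  obtain ⟨q, hq⟩ := hK.exists_isGreatest hne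
  exact ⟨p, q, (hs hp.1).1, (hs hq.1).2, fun x hx => ⟨hp.2 hx, hq.2 hx⟩⟩

/-- A test function of zero mean is the derivative of a test function. -/
lemma exists_test_primitive {L : ℝ} (hL : 0 < L) {ρ : ℝ → ℝ} (hρ : ContDiff ℝ ∞ ρ)
    (hc : HasCompactSupport ρ) (hs : tsupport ρ ⊆ Ioo 0 L) (h0 : ∫ x in (0 : ℝ)..L, ρ x = 0) :
    ∃ η : ℝ → ℝ, ContDiff ℝ ∞ η ∧ HasCompactSupport η ∧ tsupport η ⊆ Ioo 0 L ∧
      deriv η = ρ := by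
  obtain ⟨p, q, hp, hq, hpq⟩ := exists_Icc_subset_of_isCompact hL hc hs
  have hz : ∀ t, t ∉ Icc p q → ρ t = 0 := fun t ht =>
    image_eq_zero_of_notMem_tsupport fun h => ht (hpq h)
  have hd : ∀ x, HasDerivAt (fun x => ∫ t in (0 : ℝ)..x, ρ t) (ρ x) x := fun x =>
    intervalIntegral.integral_hasDerivAt_right (hρ.continuous.intervalIntegrable _ _)
      (hρ.continuous.stronglyMeasurableAtFilter _ _) hρ.continuous.continuousAt
  have hderiv : deriv (fun x => ∫ t in (0 : ℝ)..x, ρ t) = ρ := funext fun x => (hd x).deriv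
  have hsupp : tsupport (fun x => ∫ t in (0 : ℝ)..x, ρ t) ⊆ Icc p q := by
    refine closure_minimal (fun x hx => ?_) isClosed_Icc
    by_contra hxn
    refine hx ?_
    rcases lt_or_ge x p with h | h
    · refine intervalIntegral.integral_zero_ae (Filter.Eventually.of_forall fun t ht => hz t ?_)
      intro h'
      rcases le_total 0 x with h2 | h2
      · rw [uIoc_of_le h2] at ht; linarith [ht.2, h'.1]
      · rw [uIoc_of_ge h2] at ht; linarith [ht.2, h'.1]
    · have hqx : q < x := not_le.1 fun h' => hxn ⟨h, h'⟩
      have : ∫ t in (0 : ℝ)..x, ρ t = (∫ t in (0 : ℝ)..L, ρ t) + ∫ t in L..x, ρ t :=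
        (intervalIntegral.integral_add_adjacent_intervals (hρ.continuous.intervalIntegrable _ _)
          (hρ.continuous.intervalIntegrable _ _)).symm
      change ∫ t in (0 : ℝ)..x, ρ t = 0
      rw [this, h0, zero_add]
      refine intervalIntegral.integral_zero_ae (Filter.Eventually.of_forall fun t ht => hz t ?_)
      intro h'
      rcases le_total L x with h2 | h2
      · rw [uIoc_of_le h2] at ht; linarith [ht.1, h'.2]
      · rw [uIoc_of_ge h2] at ht; linarith [ht.1, h'.2]
  refine ⟨_, ?_, ?_, ?_, hderiv⟩
  · rw [contDiff_infty_iff_deriv]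
    exact ⟨fun x => (hd x).differentiableAt, by rw [hderiv]; exact hρ⟩
  · exact isCompact_Icc.of_isClosed_subset (isClosed_tsupport _) hsupp
  · exact hsupp.trans fun x hx => ⟨hp.trans_le hx.1, hx.2.trans_lt hq⟩

/-- The du Bois-Reymond lemma. -/
lemma IsWeakDeriv.eq_const_of_zero {L : ℝ} (hL : 0 < L) {h : ℝ → ℝ}
    (hcont : ContinuousOn h (Icc 0 L)) (hw : IsWeakDeriv L h (fun _ => 0)) :
    ∃ c, ∀ x ∈ Icc 0 L, h x = c := by
  obtain ⟨ρ, hρs, hρc, hρ, hρr, hρ1⟩ := exists_contDiff_tsupport_subset (n := ⊤)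
    (show Ioo 0 L ∈ nhds (L / 2) from Ioo_mem_nhds (by linarith) (by linarith))
  have hi : ∀ g : ℝ → ℝ, Continuous g → IntervalIntegrable (fun x => h x * g x) volume 0 L :=
    fun g hg => (hcont.mul hg.continuousOn).intervalIntegrable_of_Icc hL.le
  have hm : 0 < ∫ x in (0 : ℝ)..L, ρ x := by
    have h1 := integral_smul_eq_intervalIntegral hL.le (F := fun _ => 1) hρs
    simp only [smul_eq_mul, mul_one, one_mul] at h1
    rw [← h1]
    refine hρ.continuous.integral_pos_of_hasCompactSupport_nonneg_nonzero hρc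
      (fun x => (hρr (mem_range_self x)).1) (x := L / 2) (by rw [hρ1]; exact one_ne_zero)
  set m := ∫ x in (0 : ℝ)..L, ρ x
  -- The constant can only be the mean of `h` weighted by the bump `ρ`.
  set c := (∫ x in (0 : ℝ)..L, h x * ρ x) / m with hcdef
  refine ⟨c, ?_⟩
  have hae : ∀ᵐ x, x ∈ Ioo 0 L → h x - c = 0 := by
    refine isOpen_Ioo.ae_eq_zero_of_integral_contDiff_smul_eq_zero
      (((hcont.sub continuousOn_const).mono Ioo_subset_Icc_self).locallyIntegrableOn
        measurableSet_Ioo) ?_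
    intro g hg hgc hgs
    rw [integral_smul_eq_intervalIntegral hL.le hgs]
    -- Removing this multiple of `ρ` gives the test function zero mean, so that it is itself the
    -- derivative of a test function.
    set k := (∫ x in (0 : ℝ)..L, g x) / m with hk
    have hkρ : ContDiff ℝ ∞ (fun x => k * ρ x) := contDiff_const.mul hρ
    have hsup : tsupport (fun x => g x - k * ρ x) ⊆ tsupport g ∪ tsupport ρ := by
      refine closure_minimal (fun x hx => ?_) ((isClosed_tsupport g).union (isClosed_tsupport ρ))
      by_contra hn
      rw [mem_union, not_or] at hn
      refine hx ?_
      simp [image_eq_zero_of_notMem_tsupport hn.1, image_eq_zero_of_notMem_tsupport hn.2]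
    have hzero : ∫ x in (0 : ℝ)..L, (g x - k * ρ x) = 0 := by
      rw [intervalIntegral.integral_sub (hg.continuous.intervalIntegrable _ _)
        (hkρ.continuous.intervalIntegrable _ _), intervalIntegral.integral_const_mul]
      change (∫ x in (0 : ℝ)..L, g x) - k * m = 0
      rw [hk, div_mul_cancel₀ _ hm.ne', sub_self]
    obtain ⟨η, hη, hηc, hηs, hηd⟩ := exists_test_primitive hL (hg.sub hkρ)
      ((hgc.isCompact.union hρc.isCompact).of_isClosed_subset (isClosed_tsupport _) hsup)
      (hsup.trans (union_subset hgs hρs)) hzero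
    have := hw η hη hηc hηs
    rw [hηd] at this
    simp only [zero_mul, intervalIntegral.integral_zero, neg_zero] at this
    have e1 : (fun x => h x * (g x - k * ρ x)) = fun x => h x * g x - k * (h x * ρ x) := by
      funext x; ring
    rw [e1, intervalIntegral.integral_sub (hi _ hg.continuous) ((hi _ hρ.continuous).const_mul k),
      intervalIntegral.integral_const_mul] at this
    have e2 : (fun x => (h x - c) * g x) = fun x => h x * g x - c * g x := by
      funext x; ring
    rw [e2, intervalIntegral.integral_sub (hi _ hg.continuous)
      ((hg.continuous.intervalIntegrable _ _).const_mul c), intervalIntegral.integral_const_mul]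
    rw [hk] at this
    rw [hcdef]
    linear_combination this
  have := Measure.eqOn_Icc_of_ae_eq volume hL.ne (f := h) (g := fun _ => c) ?_ hcont
    continuousOn_const
  · exact this
  · rw [Filter.EventuallyEq, ae_restrict_iff' measurableSet_Icc]
    have h0 : ∀ᵐ x : ℝ, x ≠ 0 := by simp [ae_iff]
    have h1 : ∀ᵐ x : ℝ, x ≠ L := by simp [ae_iff]
    filter_upwards [hae, h0, h1] with x hx hx0 hx1 hxL
    exact sub_eq_zero.1 (hx ⟨lt_of_le_of_ne hxL.1 hx0.symm, lt_of_le_of_ne hxL.2 hx1⟩)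

/-- The fundamental theorem of calculus in `H¹(0,L)`. -/
lemma HasH1Deriv.eq_add_integral {L : ℝ} (hL : 0 < L) {f g : ℝ → ℝ} (h : HasH1Deriv L f g) :
    ∀ x ∈ Icc 0 L, f x = f 0 + ∫ t in (0 : ℝ)..x, g t := by
  have hgi := intervalIntegrable_of_memLp_two hL.le h.memLp
  have hF : HasH1Deriv L (fun x => ∫ t in (0 : ℝ)..x, g t) g :=
    ⟨by simpa [uIcc_of_le hL.le] using
        (hgi.absolutelyContinuousOnInterval_intervalIntegral (c := 0) left_mem_uIcc).continuousOn,
      h.memLp, isWeakDeriv_primitive hL.le hgi⟩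
  have hd := h.linear_comb hL.le hF 1 (-1)
  obtain ⟨c, hc⟩ := IsWeakDeriv.eq_const_of_zero hL hd.continuousOn (by
    have := hd.isWeakDeriv
    simpa using this)
  intro x hx
  have h1 := hc x hx
  have h2 := hc 0 ⟨le_rfl, hL.le⟩
  simp at h1 h2
  linarith

lemma hasH1Deriv_mul_const {L : ℝ} (hL : 0 ≤ L) (k : ℝ) :
    HasH1Deriv L (fun x => k * x) (fun _ => k) where
  continuousOn := by fun_prop
  memLp := memLp_const k
  isWeakDeriv := by
    have := isWeakDeriv_primitive hL (g := fun _ => k) (by simp)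
    simpa [mul_comm] using this

/-- A Riccati argument replaces Fourier series. The function `q = -k tan(k(x - L/2))` solves `q' =
-k² - q²` and is smooth on `[0,L]` exactly because `kL < π`. Then `(V² q)' + k² V² = g² - (g - qV)²
≤ g²`, and the exact derivative integrates to zero since the primitive `V` vanishes at both ends.
The sharp constant follows on letting `k` increase to `π / L`. -/
lemma mul_integral_sq_primitive_le {L : ℝ} (hL : 0 < L) {g : ℝ → ℝ}
    (hg : MemLp g 2 (volume.restrict (Ioo 0 L))) (h0 : ∫ t in (0 : ℝ)..L, g t = 0)
    {k : ℝ} (hk0 : 0 < k) (hk : k * L < Real.pi) :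
    k ^ 2 * ∫ x in (0 : ℝ)..L, (∫ t in (0 : ℝ)..x, g t) ^ 2 ≤ ∫ x in (0 : ℝ)..L, g x ^ 2 := by
  have hgi := intervalIntegrable_of_memLp_two hL.le hg
  have hV := hgi.absolutelyContinuousOnInterval_intervalIntegral (c := 0) left_mem_uIcc
  have hVd : ∀ᵐ x, x ∈ Icc 0 L →
      HasDerivAt (fun x => ∫ t in (0 : ℝ)..x, g t) (g x) x := by
    filter_upwards [hgi.ae_hasDerivAt_integral] with x hx hxL
    rw [uIcc_of_le hL.le] at hx
    exact hx hxL 0 ⟨le_rfl, hL.le⟩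
  set V : ℝ → ℝ := fun x => ∫ t in (0 : ℝ)..x, g t with hVdef
  set q : ℝ → ℝ := fun x => -k * Real.tan (k * (x - L / 2)) with hqdef
  have hcos : ∀ x ∈ Icc 0 L, Real.cos (k * (x - L / 2)) ≠ 0 := by
    intro x hx
    refine (Real.cos_pos_of_mem_Ioo ⟨?_, ?_⟩).ne'
    · nlinarith [hx.1, hx.2]
    · nlinarith [hx.1, hx.2]
  have hqd : ∀ x ∈ Icc 0 L, HasDerivAt q (-k ^ 2 - q x ^ 2) x := by
    intro x hx
    have h1 : HasDerivAt (fun x => k * (x - L / 2)) k x := by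
      simpa using ((hasDerivAt_id x).sub_const (L / 2)).const_mul k
    have h2 := ((Real.hasDerivAt_tan (hcos x hx)).comp x h1).const_mul (-k)
    refine h2.congr_deriv ?_
    have h3 := hcos x hx
    simp only [hqdef, Real.tan_eq_sin_div_cos]
    generalize k * (x - L / 2) = θ at h3 ⊢
    have h4 := Real.sin_sq_add_cos_sq θ
    field_simp
    linear_combination h4
  have hqc : ContDiffOn ℝ 1 q (uIcc 0 L) := by
    rw [uIcc_of_le hL.le]
    intro x hx
    refine ContDiffAt.contDiffWithinAt ?_
    exact contDiffAt_const.mul (ContDiffAt.comp (g := Real.tan) (f := fun x => k * (x - L / 2)) x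
      (Real.contDiffAt_tan.2 (hcos x hx)) (by fun_prop))
  have hqA := hqc.absolutelyContinuousOnInterval
  have key := (hV.fun_mul hV).integral_deriv_mul_eq_sub hqA
  have hVL : V L = 0 := h0
  have hV0 : V 0 = 0 := by simp [hVdef]
  rw [hVL, hV0] at key
  have hint : IntervalIntegrable (fun x => deriv (fun x => V x * V x) x * q x +
      V x * V x * deriv q x) volume 0 L :=
    ((hV.fun_mul hV).intervalIntegrable_deriv.mul_continuousOn hqA.continuousOn).add
      (hqA.intervalIntegrable_deriv.continuousOn_mul (hV.fun_mul hV).continuousOn)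
  have hV2 : IntervalIntegrable (fun x => V x ^ 2) volume 0 L :=
    ContinuousOn.intervalIntegrable (u := fun x => V x ^ 2) (hV.continuousOn.pow 2)
  have hsum : ∫ x in (0 : ℝ)..L, ((deriv (fun x => V x * V x) x * q x +
      V x * V x * deriv q x) + k ^ 2 * V x ^ 2) ≤ ∫ x in (0 : ℝ)..L, g x ^ 2 := by
    refine intervalIntegral.integral_mono_ae_restrict hL.le (hint.add (hV2.const_mul _))
      (intervalIntegrable_sq_of_memLp_two hL.le hg) ?_
    rw [Filter.EventuallyLE, ae_restrict_iff' measurableSet_Icc]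
    filter_upwards [hVd] with x hx hxL
    have h1 : deriv (fun x => V x * V x) x = g x * V x + V x * g x :=
      ((hx hxL).mul (hx hxL)).deriv
    rw [h1, (hqd x hxL).deriv]
    nlinarith [sq_nonneg (g x - q x * V x)]
  rw [intervalIntegral.integral_add hint (hV2.const_mul _), key,
    intervalIntegral.integral_const_mul] at hsum
  simpa using hsum

/-- The Poincaré inequality with the sharp constant. -/
lemma HasH1Deriv.integral_sq_le {L : ℝ} (hL : 0 < L) {v g : ℝ → ℝ} (h : HasH1Deriv L v g)
    (h0 : v 0 = 0) (h1 : v L = 0) :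
    ∫ x in (0 : ℝ)..L, v x ^ 2 ≤ L ^ 2 / Real.pi ^ 2 * ∫ x in (0 : ℝ)..L, g x ^ 2 := by
  have hv := h.eq_add_integral hL
  have hz : ∫ t in (0 : ℝ)..L, g t = 0 := by
    have := hv L ⟨hL.le, le_rfl⟩
    rw [h0, h1] at this
    linarith
  have he : ∫ x in (0 : ℝ)..L, v x ^ 2 = ∫ x in (0 : ℝ)..L, (∫ t in (0 : ℝ)..x, g t) ^ 2 := by
    refine intervalIntegral.integral_congr fun x hx => ?_
    rw [uIcc_of_le hL.le] at hx
    rw [hv x hx, h0, zero_add]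
  rw [he]
  set A := ∫ x in (0 : ℝ)..L, (∫ t in (0 : ℝ)..x, g t) ^ 2
  set B := ∫ x in (0 : ℝ)..L, g x ^ 2
  have hpi : 0 < Real.pi / L := div_pos Real.pi_pos hL
  have hlim : (Real.pi / L) ^ 2 * A ≤ B := by
    have ht : Filter.Tendsto (fun k : ℝ => k ^ 2 * A) (nhdsWithin (Real.pi / L) (Iio (Real.pi / L)))
        (nhds ((Real.pi / L) ^ 2 * A)) := by
      refine Filter.Tendsto.mono_left ?_ nhdsWithin_le_nhds
      exact (continuous_id.pow 2 |>.mul continuous_const).tendsto _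
    refine le_of_tendsto ht ?_
    filter_upwards [Ioo_mem_nhdsLT hpi] with k hk
    exact mul_integral_sq_primitive_le hL h.memLp hz hk.1 ((lt_div_iff₀ hL).1 hk.2)
  have : A = L ^ 2 / Real.pi ^ 2 * ((Real.pi / L) ^ 2 * A) := by
    have := Real.pi_pos.ne'
    field_simp
  rw [this]
  gcongr

/-- `H¹(0,L)` functions are uniformly continuous, uniformly on bounded sets. -/
lemma HasH1Deriv.abs_sub_le {L : ℝ} (hL : 0 < L) {f g : ℝ → ℝ} (h : HasH1Deriv L f g)
    {R : ℝ} (hR : ∫ x in (0 : ℝ)..L, g x ^ 2 ≤ R) {η : ℝ} (hη : 0 < η) {x y : ℝ}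
    (hx : x ∈ Icc 0 L) (hy : y ∈ Icc 0 L) :
    |f x - f y| ≤ |x - y| / η + η * R := by
  wlog hxy : y ≤ x generalizing x y
  · rw [abs_sub_comm, abs_sub_comm x y]
    exact this hy hx (le_of_not_ge hxy)
  have hgi := intervalIntegrable_of_memLp_two hL.le h.memLp
  have hg2 := intervalIntegrable_sq_of_memLp_two hL.le h.memLp
  have hs : ∀ a ∈ Icc 0 L, ∀ b ∈ Icc 0 L, uIcc a b ⊆ uIcc 0 L := fun a ha b hb => by
    rw [uIcc_of_le hL.le]; exact uIcc_subset_Icc ha hb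
  have hz : (0 : ℝ) ∈ Icc 0 L := ⟨le_rfl, hL.le⟩
  have e : f x - f y = ∫ t in y..x, g t := by
    rw [h.eq_add_integral hL x hx, h.eq_add_integral hL y hy, add_sub_add_left_eq_sub,
      intervalIntegral.integral_interval_sub_left (hgi.mono_set (hs _ hz _ hx))
        (hgi.mono_set (hs _ hz _ hy))]
  have g1 := hgi.mono_set (hs _ hy _ hx)
  have g2 := hg2.mono_set (hs _ hy _ hx)
  have h1 : |∫ t in y..x, g t| ≤ ∫ t in y..x, |g t| :=
    intervalIntegral.abs_integral_le_integral_abs hxy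
  -- Young's inequality in the form `|g| ≤ 1/η + η g²`; the free parameter `η` stands in for the
  -- square roots of Cauchy-Schwarz.
  have h2 : ∫ t in y..x, |g t| ≤ ∫ t in y..x, (1 / η + η * g t ^ 2) := by
    refine intervalIntegral.integral_mono_on hxy g1.abs
      ((intervalIntegrable_const).add (g2.const_mul η)) fun t _ => ?_
    have h3 : |g t| = (1 / η) * (η * |g t|) := by field_simp
    have h4 : 1 / η + η * g t ^ 2 = (1 / η) * (1 + (η * |g t|) ^ 2) := by
      rw [mul_pow, sq_abs]; field_simp
    rw [h3, h4]
    refine mul_le_mul_of_nonneg_left ?_ (by positivity)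
    nlinarith [sq_nonneg (η * |g t| - 1), sq_nonneg (η * |g t|)]
  rw [intervalIntegral.integral_add intervalIntegrable_const (g2.const_mul η),
    intervalIntegral.integral_const_mul, intervalIntegral.integral_const] at h2
  have h5 : ∫ t in y..x, g t ^ 2 ≤ ∫ t in (0 : ℝ)..L, g t ^ 2 :=
    intervalIntegral.integral_mono_interval hy.1 hxy hx.2
      (Filter.Eventually.of_forall fun t => sq_nonneg (g t)) hg2
  rw [e, abs_of_nonneg (sub_nonneg.2 hxy)]
  have : η * ∫ t in y..x, g t ^ 2 ≤ η * R := by gcongr; linarith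
  calc _ ≤ _ := h1.trans h2
    _ ≤ _ := by
      rw [smul_eq_mul, mul_one_div]
      linarith

/-! ### Consequences of the hypotheses on the moduli -/

lemma ModulusAssumption.iteratedDerivWithin_continuousOn {e : ℝ → ℝ} (he : ModulusAssumption e) :
    ContinuousOn (iteratedDerivWithin 2 e (Icc 0 1)) (Icc 0 1) :=
  he.contDiffOn.continuousOn_iteratedDerivWithin le_rfl (uniqueDiffOn_Icc zero_lt_one)

lemma ModulusAssumption.derivWithin_contDiffOn {e : ℝ → ℝ} (he : ModulusAssumption e) :
    ContDiffOn ℝ 1 (derivWithin e (Icc 0 1)) (Icc 0 1) :=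
  he.contDiffOn.derivWithin (uniqueDiffOn_Icc zero_lt_one) (by norm_num)

lemma iteratedDerivWithin_two_eq (e : ℝ → ℝ) (s : Set ℝ) :
    iteratedDerivWithin 2 e s = derivWithin (derivWithin e s) s := by
  rw [iteratedDerivWithin_succ', iteratedDerivWithin_one]

lemma ModulusAssumption.le_modulusM {e : ℝ → ℝ} (he : ModulusAssumption e) {y : ℝ}
    (hy : y ∈ Icc (0 : ℝ) 1) : iteratedDerivWithin 2 e (Icc 0 1) y ≤ modulusM e :=
  le_csSup (isCompact_Icc.bddAbove_image he.iteratedDerivWithin_continuousOn)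
    (mem_image_of_mem _ hy)

lemma ModulusAssumption.modulusm_le {e : ℝ → ℝ} (he : ModulusAssumption e) {y : ℝ}
    (hy : y ∈ Icc (0 : ℝ) 1) : modulusm e ≤ hardening e y :=
  csInf_le ⟨0, by rintro _ ⟨z, hz, rfl⟩; exact (he.hardening_pos z hz).le⟩ (mem_image_of_mem _ hy)

lemma ModulusAssumption.iteratedDerivWithin_nonneg {e : ℝ → ℝ} (he : ModulusAssumption e)
    (y : ℝ) : 0 ≤ iteratedDerivWithin 2 e (Icc 0 1) y := by
  rw [iteratedDerivWithin_two_eq]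
  exact (he.convexOn.monotoneOn_derivWithin
    (he.contDiffOn.differentiableOn (by norm_num))).derivWithin_nonneg

/-- From `½ e'' e - e'² ≥ m > r M ≥ r e''`. This is the condition that makes `(e - 2r)⁻¹` concave.
-/
lemma ModulusAssumption.mul_lt {e : ℝ → ℝ} (he : ModulusAssumption e) {r : ℝ} (hr : 0 < r)
    (hrm : r < modulusm e / modulusM e) {y : ℝ} (hy : y ∈ Icc (0 : ℝ) 1) :
    (derivWithin e (Icc 0 1) y) ^ 2 <
      (1 / 2) * iteratedDerivWithin 2 e (Icc 0 1) y * (e y - 2 * r) := by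
  have hm : 0 ≤ modulusm e := Real.sInf_nonneg (by
    rintro _ ⟨z, hz, rfl⟩; exact (he.hardening_pos z hz).le)
  -- A non-positive `M` would make the quotient non-positive (it is `0` when `M = 0`), so no `r > 0`
  -- could lie below it.
  have hM : 0 < modulusM e := by
    by_contra h
    exact absurd (hr.trans hrm) (not_lt.2 (div_nonpos_of_nonneg_of_nonpos hm (not_lt.1 h)))
  have h1 := he.le_modulusM hy
  have h2 := he.modulusm_le hy
  rw [lt_div_iff₀ hM] at hrm
  have h3 : r * iteratedDerivWithin 2 e (Icc 0 1) y ≤ r * modulusM e := by gcongr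
  unfold hardening at h2
  linarith

lemma ModulusAssumption.two_mul_lt {e : ℝ → ℝ} (he : ModulusAssumption e) {r : ℝ} (hr : 0 < r)
    (hrm : r < modulusm e / modulusM e) {y : ℝ} (hy : y ∈ Icc (0 : ℝ) 1) : 2 * r < e y := by
  have h1 := he.mul_lt hr hrm hy
  have h2 := he.iteratedDerivWithin_nonneg y
  have h3 := (sq_nonneg _).trans_lt h1
  by_contra h
  nlinarith [not_lt.1 h]

/-- The shifted compliance is concave. -/
lemma ModulusAssumption.concaveOn_inv {e : ℝ → ℝ} (he : ModulusAssumption e) {r : ℝ} (hr : 0 < r)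
    (hrm : r < modulusm e / modulusM e) :
    ConcaveOn ℝ (Icc 0 1) (fun y => (e y - 2 * r)⁻¹) := by
  set e' := derivWithin e (Icc 0 1) with he'
  set e'' := iteratedDerivWithin 2 e (Icc 0 1) with he''
  have hpos : ∀ y ∈ Icc (0 : ℝ) 1, 0 < e y - 2 * r := fun y hy =>
    sub_pos.2 (he.two_mul_lt hr hrm hy)
  have hd1 : ∀ y ∈ Ioo (0 : ℝ) 1, HasDerivAt e (e' y) y := fun y hy =>
    ((he.contDiffOn.differentiableOn (by norm_num) y
      (Ioo_subset_Icc_self hy)).hasDerivWithinAt).hasDerivAt (Icc_mem_nhds hy.1 hy.2)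
  have hd2 : ∀ y ∈ Ioo (0 : ℝ) 1, HasDerivAt e' (e'' y) y := fun y hy => by
    rw [he'', iteratedDerivWithin_two_eq]
    exact ((he.derivWithin_contDiffOn.differentiableOn (by norm_num) y
      (Ioo_subset_Icc_self hy)).hasDerivWithinAt).hasDerivAt (Icc_mem_nhds hy.1 hy.2)
  refine concaveOn_of_hasDerivWithinAt2_nonpos (convex_Icc 0 1)
    (f' := fun y => -e' y / (e y - 2 * r) ^ 2)
    (f'' := fun y => (-e'' y * (e y - 2 * r) ^ 2 - -e' y * (2 * (e y - 2 * r) * e' y)) /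
      ((e y - 2 * r) ^ 2) ^ 2) ?_ ?_ ?_ ?_
  · exact (he.contDiffOn.continuousOn.sub continuousOn_const).inv₀ fun y hy => (hpos y hy).ne'
  · intro y hy
    rw [interior_Icc] at hy ⊢
    exact (((hd1 y hy).sub_const _).inv (hpos y (Ioo_subset_Icc_self hy)).ne').hasDerivWithinAt
  · intro y hy
    rw [interior_Icc] at hy ⊢
    have h1 : HasDerivAt (fun y => (e y - 2 * r) ^ 2) (2 * (e y - 2 * r) * e' y) y := by
      exact (((hd1 y hy).sub_const (2 * r)).pow 2).congr_deriv (by simp)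
    exact ((hd2 y hy).neg.div h1
      (pow_ne_zero 2 (hpos y (Ioo_subset_Icc_self hy)).ne')).hasDerivWithinAt
  · intro y hy
    rw [interior_Icc] at hy
    refine div_nonpos_of_nonpos_of_nonneg ?_ (by positivity)
    have h1 := he.mul_lt hr hrm (Ioo_subset_Icc_self hy)
    have h2 := hpos y (Ioo_subset_Icc_self hy)
    -- Up to positive factors the second derivative is `e'² - ½ e''(e - 2r)`, which is negative by
    -- `mul_lt`.
    have h3 : -e'' y * (e y - 2 * r) ^ 2 - -e' y * (2 * (e y - 2 * r) * e' y) =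
      (e y - 2 * r) * (2 * (e' y ^ 2 - 1 / 2 * e'' y * (e y - 2 * r))) := by ring
    rw [h3]
    refine mul_nonpos_of_nonneg_of_nonpos h2.le ?_
    linarith

/-- Midpoint uniform convexity of the elastic energy density. -/
lemma ModulusAssumption.midpoint_le {e : ℝ → ℝ} (he : ModulusAssumption e) {r : ℝ} (hr : 0 < r)
    (hrm : r < modulusm e / modulusM e) {a b : ℝ} (ha : a ∈ Icc (0 : ℝ) 1)
    (hb : b ∈ Icc (0 : ℝ) 1) (p q : ℝ) :
    e (1 / 2 * a + 1 / 2 * b) * (1 / 2 * p + 1 / 2 * q) ^ 2 + r / 2 * (p - q) ^ 2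
      ≤ 1 / 2 * (e a * p ^ 2) + 1 / 2 * (e b * q ^ 2) := by
  have hmid : 1 / 2 * a + 1 / 2 * b ∈ Icc (0 : ℝ) 1 := by
    constructor <;> linarith [ha.1, ha.2, hb.1, hb.2]
  have hc := (he.concaveOn_inv hr hrm).2 ha hb (by norm_num : (0 : ℝ) ≤ 1 / 2)
    (by norm_num : (0 : ℝ) ≤ 1 / 2) (by norm_num)
  simp only [smul_eq_mul] at hc
  have hA := he.two_mul_lt hr hrm ha
  have hB := he.two_mul_lt hr hrm hb
  have hD := he.two_mul_lt hr hrm hmid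
  obtain ⟨A, hAe⟩ : ∃ A, A = e a - 2 * r := ⟨_, rfl⟩
  obtain ⟨B, hBe⟩ : ∃ B, B = e b - 2 * r := ⟨_, rfl⟩
  obtain ⟨D, hDe⟩ : ∃ D, D = e (1 / 2 * a + 1 / 2 * b) - 2 * r := ⟨_, rfl⟩
  rw [← hAe, ← hBe, ← hDe] at hc
  have hA0 : 0 < A := by linarith
  have hB0 : 0 < B := by linarith
  have hD0 : 0 < D := by linarith
  have h1 : D * (A + B) ≤ 2 * (A * B) := by
    have : 1 / 2 * A⁻¹ + 1 / 2 * B⁻¹ = (A + B) / (2 * (A * B)) := by field_simp; ring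
    rw [this, div_le_iff₀ (by positivity), inv_mul_eq_div, le_div_iff₀ hD0] at hc
    linarith
  -- Since `(A + B)(A p² + B q²) - AB(p + q)² = (A p - B q)²`, the bound `D(A + B) ≤ 2AB` suffices.
  -- The shift `2r` restored afterwards contributes, by the parallelogram identity, exactly the gain
  -- `r/2 (p - q)²`.
  have h2 : D * (p + q) ^ 2 ≤ 2 * (A * p ^ 2 + B * q ^ 2) := by
    have h3 : (A + B) * (D * (p + q) ^ 2) ≤ (A + B) * (2 * (A * p ^ 2 + B * q ^ 2)) := by
      nlinarith [mul_le_mul_of_nonneg_right h1 (sq_nonneg (p + q)), sq_nonneg (A * p - B * q)]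
    exact le_of_mul_le_mul_left h3 (by positivity)
  rw [show e a = A + 2 * r by linarith, show e b = B + 2 * r by linarith,
    show e (1 / 2 * a + 1 / 2 * b) = D + 2 * r by linarith]
  nlinarith

/-! ### Consequences of the hypotheses on the density -/

section Density

variable {φ : ℝ → ℝ → ℝ} {lam : ℝ}

/-- Approach `(y, z)` vertically from below. The value `z = deltaBar` is thereby included, so strict
monotonicity can be used right up to the threshold. -/
lemma mem_closure_domTBar {y z : ℝ} (hy : 0 ≤ y) (hyz : y < z) (hz : (z : EReal) ≤ deltaBar φ) :
    (y, z) ∈ closure (domTBar φ) := by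
  have ht : Filter.Tendsto (fun t : ℝ => (y, t)) (nhdsWithin z (Iio z)) (nhds (y, z)) :=
    ((Continuous.prodMk_right y).tendsto z).mono_left nhdsWithin_le_nhds
  refine mem_closure_of_tendsto ht ?_
  filter_upwards [Ioo_mem_nhdsLT hyz] with t ht
  exact ⟨⟨hy, ht.1.le⟩, (EReal.coe_lt_coe_iff.2 ht.2).trans_le hz⟩

lemma DensityAssumption.diag_hasDerivWithinAt (h : DensityAssumption φ lam) {z : ℝ} (hz : 0 ≤ z) :
    HasDerivWithinAt (diag φ) (derivWithin (diag φ) (Ici 0) z) (Ici 0) z :=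
  (h.diag_contDiffOn.differentiableOn (by norm_num) z hz).hasDerivWithinAt

lemma DensityAssumption.left_hasDerivWithinAt (h : DensityAssumption φ lam) {y z : ℝ} (hz : 0 < z)
    (hy : y ∈ Icc 0 z) : HasDerivWithinAt (fun y => φ y z) (partialY φ y z) (Icc 0 z) y :=
  ((h.contDiffOn_left z hz).differentiableOn (by norm_num) y hy).hasDerivWithinAt

/-- The infimum defining `deltaBar` need not be attained: `ψ` is first seen to be constant on `[z',
∞)` for every `z' > z`, and continuity then adds the point `z`. -/
lemma DensityAssumption.diag_eq_of_deltaBar_le (h : DensityAssumption φ lam) {z s : ℝ}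
    (hz : 0 ≤ z) (hd : deltaBar φ ≤ z) (hs : z ≤ s) : diag φ s = diag φ z := by
  have key : ∀ z', z < z' → ∀ s, z' ≤ s → diag φ s = diag φ z' := by
    intro z' hz' s hs
    obtain ⟨_, ⟨z'', h1, rfl⟩, h2⟩ := sInf_lt_iff.1 (hd.trans_lt (EReal.coe_lt_coe_iff.2 hz'))
    have h3 : z'' ≤ z' := (EReal.coe_lt_coe_iff.1 h2).le
    rw [h1.2 s (h3.trans hs), h1.2 z' h3]
  rcases hs.eq_or_lt with rfl | hs
  · rfl
  have ht : Filter.Tendsto (diag φ) (nhdsWithin z (Ioi z)) (nhds (diag φ z)) :=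
    (h.diag_contDiffOn.continuousOn z hz).mono_left
      (nhdsWithin_mono z fun x hx => hz.trans (le_of_lt hx))
  refine tendsto_nhds_unique (tendsto_const_nhds.congr' ?_) ht
  filter_upwards [Ioo_mem_nhdsGT hs] with t ht
  exact key t ht.1 s ht.2.le

/-- Beyond the threshold `ψ'(z) = 0`, so by compatibility `φ(·,z)` has slope zero at its right end.
A convex non-decreasing function with this property is constant. -/
lemma DensityAssumption.eq_diag_of_deltaBar_le (h : DensityAssumption φ lam) {y z : ℝ}
    (hz : 0 < z) (hd : deltaBar φ ≤ z) (hy : y ∈ Icc 0 z) : φ y z = diag φ z := by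
  have h0 : derivWithin (diag φ) (Ici 0) z = 0 := by
    have h1 := (h.diag_hasDerivWithinAt hz.le).mono (Ici_subset_Ici.2 hz.le)
    have h2 : HasDerivWithinAt (diag φ) 0 (Ici z) z :=
      (hasDerivWithinAt_const z (Ici z) (diag φ z)).congr_of_mem
        (fun s hs => h.diag_eq_of_deltaBar_le hz.le hd hs) self_mem_Ici
    exact (uniqueDiffOn_Ici z z self_mem_Ici).eq_deriv _ h1 h2
  have hzz : z ∈ Icc 0 z := ⟨hz.le, le_rfl⟩
  rcases hy.2.eq_or_lt with rfl | hlt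
  · rfl
  refine le_antisymm (h.monotoneOn_left z hz hy hzz hy.2) ?_
  have h3 := (h.convexOn_left z hz).slope_le_derivWithin hy hzz hlt
    (h.left_hasDerivWithinAt hz hzz).differentiableWithinAt
  have h4 : derivWithin (fun y => φ y z) (Icc 0 z) z = 0 := (h.partialY_diag z hz).trans h0
  rw [h4, slope_def_field, div_nonpos_iff] at h3
  rcases h3 with h3 | h3
  · linarith
  · exact sub_nonpos.1 h3.1

/-- The density is non-decreasing in the second variable. -/
lemma DensityAssumption.mono_right (h : DensityAssumption φ lam) (hm : UniformStrictMono φ)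
    {y z₁ z₂ : ℝ} (hy : 0 ≤ y) (h₁ : y ≤ z₁) (h₂ : z₁ ≤ z₂) : φ y z₁ ≤ φ y z₂ := by
  have pair : ∀ z₁ z₂ : ℝ, y < z₁ → z₁ ≤ z₂ → (z₂ : EReal) ≤ deltaBar φ → φ y z₁ ≤ φ y z₂ := by
    intro z₁ z₂ h₁ h₂ hd
    -- For mere monotonicity a two-point compact set is enough.
    obtain ⟨C, hC, hK⟩ := hm {(y, z₁), (y, z₂)} (toFinite _).isCompact (by
      rintro p (rfl | rfl)
      · exact ⟨⟨hy, h₁⟩, mem_closure_domTBar hy h₁ ((EReal.coe_le_coe_iff.2 h₂).trans hd)⟩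
      · exact ⟨⟨hy, h₁.trans_le h₂⟩, mem_closure_domTBar hy (h₁.trans_le h₂) hd⟩)
    have := hK y z₁ z₂ (by simp) (by simp) h₂
    have : 0 ≤ C * (z₂ - z₁) := mul_nonneg hC.le (sub_nonneg.2 h₂)
    linarith
  have const : ∀ z₁ z₂ : ℝ, y ≤ z₁ → 0 < z₁ → z₁ ≤ z₂ → deltaBar φ ≤ z₁ → φ y z₁ = φ y z₂ := by
    intro z₁ z₂ h₁ h0 h₂ hd
    rw [h.eq_diag_of_deltaBar_le h0 hd ⟨hy, h₁⟩,
      h.eq_diag_of_deltaBar_le (h0.trans_le h₂) (hd.trans (EReal.coe_le_coe_iff.2 h₂))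
        ⟨hy, h₁.trans h₂⟩, h.diag_eq_of_deltaBar_le h0.le hd h₂]
  have strict : ∀ z₁ z₂ : ℝ, y < z₁ → z₁ ≤ z₂ → φ y z₁ ≤ φ y z₂ := by
    intro z₁ z₂ h₁ h₂
    rcases le_or_gt (deltaBar φ) z₁ with hd | hd
    · exact (const z₁ z₂ h₁.le (hy.trans_lt h₁) h₂ hd).le
    rcases le_or_gt (z₂ : EReal) (deltaBar φ) with hd2 | hd2
    · exact pair z₁ z₂ h₁ h₂ hd2
    -- The threshold lies between `z₁` and `z₂`, hence is a real number: `φ(y, ·)` is non-decreasing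
    -- up to it and constant after it.
    have hcoe : ((deltaBar φ).toReal : EReal) = deltaBar φ :=
      EReal.coe_toReal hd2.ne_top hd.ne_bot
    rw [← hcoe, EReal.coe_lt_coe_iff] at hd hd2
    refine (pair z₁ _ h₁ hd.le hcoe.le).trans (const _ z₂ (h₁.trans hd).le ?_ hd2.le hcoe.ge).le
    linarith
  rcases h₁.eq_or_lt with rfl | h₁
  · rcases h₂.eq_or_lt with rfl | h₂
    · rfl
    -- The diagonal point `z₁ = y` lies outside the region of strict monotonicity and is reached as
    -- a limit from above.
    have ht : Filter.Tendsto (fun t : ℝ => φ y t) (nhdsWithin y (Ioi y)) (nhds (φ y y)) := by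
      have h1 : Filter.Tendsto (fun t : ℝ => (y, t)) (nhdsWithin y (Ioi y))
          (nhdsWithin (y, y) domT) := by
        refine tendsto_nhdsWithin_iff.2 ⟨((Continuous.prodMk_right y).tendsto y).mono_left
          nhdsWithin_le_nhds, ?_⟩
        filter_upwards [self_mem_nhdsWithin] with t ht
        exact ⟨hy, le_of_lt ht⟩
      exact (h.continuousOn (y, y) ⟨hy, le_rfl⟩).tendsto.comp h1
    refine le_of_tendsto ht ?_
    filter_upwards [Ioo_mem_nhdsGT h₂] with t ht
    exact strict t z₂ ht.1 ht.2.le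
  · exact strict z₁ z₂ h₁ h₂

/-- Growth of the density in the second variable away from the diagonal. -/
lemma DensityAssumption.exists_growth (h : DensityAssumption φ lam) (hm : UniformStrictMono φ)
    {y₀ c b : ℝ} (hc : y₀ < c) (hcb : c ≤ b) (hb : (b : EReal) ≤ deltaBar φ) :
    ∃ C : ℝ, 0 < C ∧ ∀ y z₁ z₂ : ℝ, 0 ≤ y → y ≤ y₀ → y ≤ z₁ → z₁ ≤ z₂ →
      C * (max c (min z₂ b) - max c (min z₁ b)) ≤ φ y z₂ - φ y z₁ := by
  -- The rectangle avoids the diagonal because `y₀ < c` and stays in the closure because `b ≤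
  -- deltaBar`. Growth outside `[c, b]` is discarded by `mono_right`, which is why the conclusion
  -- involves truncated values.
  obtain ⟨C, hC, hK⟩ := hm (Icc 0 y₀ ×ˢ Icc c b) (isCompact_Icc.prod isCompact_Icc) (by
    rintro ⟨y, z⟩ ⟨h1, h2⟩
    exact ⟨⟨h1.1, h1.2.trans_lt (hc.trans_le h2.1)⟩, mem_closure_domTBar h1.1
      (h1.2.trans_lt (hc.trans_le h2.1)) ((EReal.coe_le_coe_iff.2 h2.2).trans hb)⟩)
  refine ⟨C, hC, fun y z₁ z₂ hy0 hy hz₁ hz₂ => ?_⟩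
  have hmono := h.mono_right hm hy0 hz₁ hz₂
  rcases le_total z₂ c with h1 | h1
  · rw [max_eq_left ((min_le_left _ _).trans h1), max_eq_left ((min_le_left _ _).trans
      (hz₂.trans h1)), sub_self, mul_zero]
    linarith
  rcases le_total b z₁ with h2 | h2
  · rw [min_eq_right h2, min_eq_right (h2.trans hz₂), sub_self, mul_zero]
    linarith
  rw [min_eq_left h2]
  have e2 : max c (min z₂ b) = min z₂ b := max_eq_right (le_min h1 hcb)
  have h3 : φ y (min z₂ b) ≤ φ y z₂ :=
    h.mono_right hm hy0 ((hy.trans hc.le).trans (le_min h1 hcb)) (min_le_left _ _)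
  have h4 : φ y z₁ ≤ φ y (max c z₁) := h.mono_right hm hy0 hz₁ (le_max_right _ _)
  have h5 := hK y (max c z₁) (min z₂ b) ⟨⟨hy0, hy⟩, le_max_left _ _, max_le hcb h2⟩
    ⟨⟨hy0, hy⟩, le_min h1 hcb, min_le_right _ _⟩
    (max_le (le_min h1 hcb) (le_min hz₂ h2))
  rw [e2]
  linarith

/-! ### Convexity of the regularised density in the slip. -/

lemma DensityAssumption.convexOn_diag_add (h : DensityAssumption φ lam) :
    ConvexOn ℝ (Ici 0) (fun y => diag φ y + lam / 2 * y ^ 2) := by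
  refine ⟨convex_Ici 0, fun a ha b hb s t hs ht hst => ?_⟩
  obtain rfl : t = 1 - s := by linarith
  have := h.diag_convex s ⟨hs, by linarith⟩ a ha b hb
  simp only [smul_eq_mul]
  rw [sq_abs] at this
  nlinarith

/-- The derivative of `y ↦ φ(y, z ∨ y) + lam/2 y²`. -/
noncomputable def regularisedDeriv (φ : ℝ → ℝ → ℝ) (lam z y : ℝ) : ℝ :=
  (if y ≤ z then partialY φ y z else derivWithin (diag φ) (Ici 0) y) + lam * y

/-- The unloading branch `φ(·,z)` and the loading branch `ψ` join at `y = z` without a kink, by the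
compatibility `∂_y φ(z,z) = ψ'(z)`. -/
lemma DensityAssumption.hasDerivAt_regularised (h : DensityAssumption φ lam) {z y : ℝ}
    (hz : 0 ≤ z) (hy : 0 < y) :
    HasDerivAt (fun y => φ y (max z y) + lam / 2 * y ^ 2) (regularisedDeriv φ lam z y) y := by
  have hq : HasDerivAt (fun y : ℝ => lam / 2 * y ^ 2) (lam * y) y := by
    refine ((hasDerivAt_pow 2 y).const_mul (lam / 2)).congr_deriv ?_
    simp
    ring
  refine HasDerivAt.add ?_ hq
  rcases lt_trichotomy y z with hlt | rfl | hgt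
  · rw [if_pos hlt.le]
    have h1 := (h.left_hasDerivWithinAt (hy.trans hlt) ⟨hy.le, hlt.le⟩).hasDerivAt
      (Icc_mem_nhds hy hlt)
    refine h1.congr_of_eventuallyEq ?_
    filter_upwards [Iio_mem_nhds hlt] with s hs
    rw [max_eq_left (le_of_lt hs)]
  · rw [if_pos le_rfl, ← hasDerivWithinAt_univ, ← Iic_union_Ici (a := y)]
    refine HasDerivWithinAt.union ?_ ?_
    · have h1 : HasDerivWithinAt (fun s => φ s y) (partialY φ y y) (Iic y) y :=
        (h.left_hasDerivWithinAt hy ⟨hy.le, le_rfl⟩).mono_of_mem_nhdsWithin (by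
          rw [← Ici_inter_Iic, inter_comm]
          exact inter_mem_nhdsWithin _ (Ici_mem_nhds hy))
      exact h1.congr_of_mem (fun s hs => by rw [max_eq_left hs]) self_mem_Iic
    · rw [h.partialY_diag y hy]
      exact ((h.diag_hasDerivWithinAt hy.le).mono (Ici_subset_Ici.2 hy.le)).congr_of_mem
        (fun s hs => by rw [max_eq_right hs]; rfl) self_mem_Ici
  · rw [if_neg (not_le.2 hgt)]
    have h1 := (h.diag_hasDerivWithinAt hy.le).hasDerivAt (Ici_mem_nhds hy)
    refine h1.congr_of_eventuallyEq ?_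
    filter_upwards [Ioi_mem_nhds hgt] with s hs
    rw [max_eq_right (le_of_lt hs)]
    rfl

lemma DensityAssumption.continuousOn_regularised (h : DensityAssumption φ lam) {z : ℝ} :
    ContinuousOn (fun y => φ y (max z y) + lam / 2 * y ^ 2) (Ici 0) := by
  refine ContinuousOn.add ?_ (by fun_prop)
  exact h.continuousOn.comp (f := fun y => (y, max z y)) (by fun_prop)
    fun y hy => ⟨hy, le_max_right _ _⟩

lemma DensityAssumption.partialY_nonneg (h : DensityAssumption φ lam) {y z : ℝ} (hz : 0 < z) :
    0 ≤ partialY φ y z :=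
  (h.monotoneOn_left z hz).derivWithin_nonneg

lemma DensityAssumption.regularisedDeriv_nonneg (h : DensityAssumption φ lam) (hlam : 0 ≤ lam)
    {z y : ℝ} (hy : 0 < y) : 0 ≤ regularisedDeriv φ lam z y := by
  refine add_nonneg ?_ (mul_nonneg hlam hy.le)
  split_ifs with hyz
  · exact h.partialY_nonneg (hy.trans_le hyz)
  · rw [← h.partialY_diag y hy]
    exact h.partialY_nonneg hy

/-- Below `z` the derivative increases by convexity of `φ(·,z)`, above `z` by convexity of `ψ +
lam/2 y²`. The two branches agree at `z`, so the comparison across `z` goes through that point. -/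
lemma DensityAssumption.regularisedDeriv_mono (h : DensityAssumption φ lam) (hlam : 0 ≤ lam)
    {z : ℝ} : MonotoneOn (regularisedDeriv φ lam z) (Ioi 0) := by
  have hleft : ∀ a b, 0 < a → a ≤ b → b ≤ z → partialY φ a z ≤ partialY φ b z := by
    intro a b ha hab hb
    have hz : 0 < z := ha.trans_le (hab.trans hb)
    exact (h.convexOn_left z hz).monotoneOn_derivWithin
      ((h.contDiffOn_left z hz).differentiableOn (by norm_num)) ⟨ha.le, hab.trans hb⟩
      ⟨ha.le.trans hab, hb⟩ hab
  have hright : ∀ a b, 0 < a → a ≤ b → derivWithin (diag φ) (Ici 0) a + lam * a ≤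
      derivWithin (diag φ) (Ici 0) b + lam * b := by
    have hd : ∀ y, 0 ≤ y → HasDerivWithinAt (fun y => diag φ y + lam / 2 * y ^ 2)
        (derivWithin (diag φ) (Ici 0) y + lam * y) (Ici 0) y := by
      intro y hy
      refine (h.diag_hasDerivWithinAt hy).add ?_
      refine (((hasDerivAt_pow 2 y).const_mul (lam / 2)).congr_deriv ?_).hasDerivWithinAt
      simp
      ring
    intro a b ha hab
    have h1 := h.convexOn_diag_add.monotoneOn_derivWithin
      (fun y hy => (hd y hy).differentiableWithinAt) ha.le (ha.le.trans hab) hab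
    rwa [(hd a ha.le).derivWithin (uniqueDiffOn_Ici 0 a ha.le),
      (hd b (ha.le.trans hab)).derivWithin (uniqueDiffOn_Ici 0 b (ha.le.trans hab))] at h1
  intro a ha b hb hab
  unfold regularisedDeriv
  have hl : lam * a ≤ lam * b := by gcongr
  rcases le_or_gt b z with hbz | hbz
  · rw [if_pos hbz, if_pos (hab.trans hbz)]
    exact add_le_add (hleft a b ha hab hbz) hl
  rw [if_neg (not_le.2 hbz)]
  rcases le_or_gt a z with haz | haz
  · rw [if_pos haz]
    have hz : 0 < z := lt_of_lt_of_le ha haz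
    have h1 := hleft a z ha haz le_rfl
    rw [h.partialY_diag z hz] at h1
    have h2 := hright z b hz hbz.le
    have : lam * a ≤ lam * z := by gcongr
    linarith
  · rw [if_neg (not_le.2 haz)]
    exact hright a b ha hab

/-- Midpoint `lam`-convexity of `v ↦ φ(|v|, z ∨ |v|)`. -/
lemma DensityAssumption.midpoint_le (h : DensityAssumption φ lam) (hlam : 0 ≤ lam) {z : ℝ}
    (hz : 0 ≤ z) (p q : ℝ) :
    φ |1 / 2 * p + 1 / 2 * q| (max z |1 / 2 * p + 1 / 2 * q|) ≤
      1 / 2 * φ |p| (max z |p|) + 1 / 2 * φ |q| (max z |q|) + lam / 8 * (p - q) ^ 2 := by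
  set H : ℝ → ℝ := fun y => φ y (max z y) + lam / 2 * y ^ 2 with hH
  have hd : ∀ y ∈ Ioi (0 : ℝ), HasDerivAt H (regularisedDeriv φ lam z y) y := fun y hy =>
    h.hasDerivAt_regularised hz hy
  have hconv : ConvexOn ℝ (Ici 0) H := by
    refine MonotoneOn.convexOn_of_deriv (convex_Ici 0) h.continuousOn_regularised ?_ ?_
    · rw [interior_Ici]
      exact fun y hy => (hd y hy).differentiableAt.differentiableWithinAt
    · rw [interior_Ici]
      exact (h.regularisedDeriv_mono hlam).congr fun y hy => ((hd y hy).deriv).symm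
  -- Monotonicity lets the convexity of `H` survive composition with the absolute value. The added
  -- quadratic is finally removed by the parallelogram identity, which leaves `lam/8 (p - q)²`.
  have hmono : MonotoneOn H (Ici 0) := by
    refine monotoneOn_of_deriv_nonneg (convex_Ici 0) h.continuousOn_regularised ?_ ?_
    · rw [interior_Ici]
      exact fun y hy => (hd y hy).differentiableAt.differentiableWithinAt
    · rw [interior_Ici]
      intro y hy
      rw [(hd y hy).deriv]
      exact h.regularisedDeriv_nonneg hlam hy
  have h1 : |1 / 2 * p + 1 / 2 * q| ≤ 1 / 2 * |p| + 1 / 2 * |q| := by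
    refine (abs_add_le _ _).trans ?_
    rw [abs_mul, abs_mul, abs_of_pos (by norm_num : (0 : ℝ) < 1 / 2)]
  have h2 := hmono (mem_Ici.2 (abs_nonneg _))
    (mem_Ici.2 (by positivity : (0 : ℝ) ≤ 1 / 2 * |p| + 1 / 2 * |q|)) h1
  have h3 := hconv.2 (mem_Ici.2 (abs_nonneg p)) (mem_Ici.2 (abs_nonneg q))
    (by norm_num : (0 : ℝ) ≤ 1 / 2) (by norm_num : (0 : ℝ) ≤ 1 / 2) (by norm_num)
  simp only [smul_eq_mul] at h3
  have h4 := h2.trans h3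
  simp only [hH, sq_abs] at h4
  linarith

end Density

/-! ### Uniform convexity of the total energy -/

lemma intervalIntegrable_comp_mul {L : ℝ} (hL : 0 ≤ L) {e a f : ℝ → ℝ}
    (he : ContinuousOn e (Icc 0 1)) (ha : MemH1Unit L a) (hf : IntervalIntegrable f volume 0 L) :
    IntervalIntegrable (fun x => e (a x) * f x) volume 0 L := by
  refine hf.continuousOn_mul ?_
  rw [uIcc_of_le hL]
  exact he.comp ha.1.1 ha.2

lemma intervalIntegrable_comp {L : ℝ} (hL : 0 ≤ L) {e a : ℝ → ℝ}
    (he : ContinuousOn e (Icc 0 1)) (ha : MemH1Unit L a) :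
    IntervalIntegrable (fun x => e (a x)) volume 0 L :=
  (he.comp ha.1.1 ha.2).intervalIntegrable_of_Icc hL

lemma MemH1.memLp {L : ℝ} {f : ℝ → ℝ} (h : MemH1 L f) :
    MemLp (weakDeriv L f) 2 (volume.restrict (Ioo 0 L)) := h.hasH1Deriv.memLp

lemma MemH1.intervalIntegrable_weakDeriv {L : ℝ} (hL : 0 ≤ L) {f : ℝ → ℝ} (h : MemH1 L f) :
    IntervalIntegrable (weakDeriv L f) volume 0 L := intervalIntegrable_of_memLp_two hL h.memLp

lemma MemH1.intervalIntegrable_weakDeriv_sq {L : ℝ} (hL : 0 ≤ L) {f : ℝ → ℝ} (h : MemH1 L f) :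
    IntervalIntegrable (fun x => weakDeriv L f x ^ 2) volume 0 L :=
  intervalIntegrable_sq_of_memLp_two hL h.memLp

lemma MemH1.intervalIntegrable_weakDeriv_sub_sq {L : ℝ} (hL : 0 ≤ L) {f g : ℝ → ℝ}
    (hf : MemH1 L f) (hg : MemH1 L g) :
    IntervalIntegrable (fun x => (weakDeriv L f x - weakDeriv L g x) ^ 2) volume 0 L :=
  intervalIntegrable_sq_of_memLp_two hL (hf.memLp.sub hg.memLp)

lemma HasH1Deriv.weakDeriv_ae {L : ℝ} (hL : 0 ≤ L) {f g : ℝ → ℝ} (h : HasH1Deriv L f g) :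
    ∀ᵐ x, x ∈ Ioo 0 L → weakDeriv L f x = g x := h.memH1.hasH1Deriv.ae_eq hL h

lemma integral_congr_ae_Ioo {L : ℝ} (hL : 0 ≤ L) {f g : ℝ → ℝ}
    (h : ∀ᵐ x, x ∈ Ioo 0 L → f x = g x) :
    ∫ x in (0 : ℝ)..L, f x = ∫ x in (0 : ℝ)..L, g x := by
  rw [intervalIntegral.integral_of_le hL, intervalIntegral.integral_of_le hL,
    integral_Ioc_eq_integral_Ioo, integral_Ioc_eq_integral_Ioo]
  exact setIntegral_congr_ae measurableSet_Ioo h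

/-- The midpoint of two functions. -/
noncomputable def midpt (f g : ℝ → ℝ) (x : ℝ) : ℝ := 1 / 2 * f x + 1 / 2 * g x

lemma MemH1.hasH1Deriv_midpt {L : ℝ} (hL : 0 ≤ L) {f g : ℝ → ℝ} (hf : MemH1 L f)
    (hg : MemH1 L g) : HasH1Deriv L (midpt f g) (midpt (weakDeriv L f) (weakDeriv L g)) :=
  hf.hasH1Deriv.linear_comb hL hg.hasH1Deriv _ _

lemma MemH1Unit.midpt {L : ℝ} (hL : 0 ≤ L) {a b : ℝ → ℝ} (ha : MemH1Unit L a)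
    (hb : MemH1Unit L b) : MemH1Unit L (midpt a b) :=
  ⟨(ha.1.hasH1Deriv_midpt hL hb.1).memH1, fun x hx => by
    have h1 := ha.2 x hx
    have h2 := hb.2 x hx
    constructor <;> simp only [CohesiveLaminate.midpt] <;> linarith [h1.1, h1.2, h2.1, h2.2]⟩

lemma MemH1Bdry.midpt {L c : ℝ} (hL : 0 ≤ L) {a b : ℝ → ℝ} (ha : MemH1Bdry L c a)
    (hb : MemH1Bdry L c b) : MemH1Bdry L c (midpt a b) :=
  ⟨(ha.1.hasH1Deriv_midpt hL hb.1).memH1, by simp [CohesiveLaminate.midpt, ha.2.1, hb.2.1], by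
    simp only [CohesiveLaminate.midpt, ha.2.2, hb.2.2]; ring⟩

lemma elastic_midpoint_le {L : ℝ} (hL : 0 ≤ L) {e : ℝ → ℝ} (he : ModulusAssumption e) {r : ℝ}
    (hr : 0 < r) (hrm : r < modulusm e / modulusM e) {u v a b : ℝ → ℝ} (hu : MemH1 L u)
    (hv : MemH1 L v) (ha : MemH1Unit L a) (hb : MemH1Unit L b) :
    (∫ x in (0 : ℝ)..L, e (midpt a b x) * weakDeriv L (midpt u v) x ^ 2)
      + r / 2 * ∫ x in (0 : ℝ)..L, (weakDeriv L u x - weakDeriv L v x) ^ 2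
      ≤ 1 / 2 * (∫ x in (0 : ℝ)..L, e (a x) * weakDeriv L u x ^ 2)
        + 1 / 2 * ∫ x in (0 : ℝ)..L, e (b x) * weakDeriv L v x ^ 2 := by
  have hec := he.contDiffOn.continuousOn
  have hm := hu.hasH1Deriv_midpt hL hv
  have e1 : ∫ x in (0 : ℝ)..L, e (midpt a b x) * weakDeriv L (midpt u v) x ^ 2 =
      ∫ x in (0 : ℝ)..L, e (midpt a b x) * midpt (weakDeriv L u) (weakDeriv L v) x ^ 2 := by
    refine integral_congr_ae_Ioo hL ?_
    filter_upwards [hm.weakDeriv_ae hL] with x hx hxL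
    rw [hx hxL]
  have i1 := intervalIntegrable_comp_mul hL hec (ha.midpt hL hb)
    (intervalIntegrable_sq_of_memLp_two hL hm.memLp)
  have i2 := (hu.intervalIntegrable_weakDeriv_sub_sq hL hv).const_mul (r / 2)
  have i3 := (intervalIntegrable_comp_mul hL hec ha
    (hu.intervalIntegrable_weakDeriv_sq hL)).const_mul (1 / 2)
  have i4 := (intervalIntegrable_comp_mul hL hec hb
    (hv.intervalIntegrable_weakDeriv_sq hL)).const_mul (1 / 2)
  rw [e1, ← intervalIntegral.integral_const_mul, ← intervalIntegral.integral_const_mul,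
    ← intervalIntegral.integral_const_mul, ← intervalIntegral.integral_add i1 i2,
    ← intervalIntegral.integral_add i3 i4]
  exact intervalIntegral.integral_mono_on hL (i1.add i2) (i3.add i4) fun x hx =>
    he.midpoint_le hr hrm (ha.2 x hx) (hb.2 x hx) _ _

lemma gradient_midpoint_le {L : ℝ} (hL : 0 ≤ L) {a b : ℝ → ℝ} (ha : MemH1 L a)
    (hb : MemH1 L b) :
    (∫ x in (0 : ℝ)..L, weakDeriv L (midpt a b) x ^ 2)
      ≤ 1 / 2 * (∫ x in (0 : ℝ)..L, weakDeriv L a x ^ 2)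
        + 1 / 2 * ∫ x in (0 : ℝ)..L, weakDeriv L b x ^ 2 := by
  have hm := ha.hasH1Deriv_midpt hL hb
  have e1 : ∫ x in (0 : ℝ)..L, weakDeriv L (midpt a b) x ^ 2 =
      ∫ x in (0 : ℝ)..L, midpt (weakDeriv L a) (weakDeriv L b) x ^ 2 := by
    refine integral_congr_ae_Ioo hL ?_
    filter_upwards [hm.weakDeriv_ae hL] with x hx hxL
    rw [hx hxL]
  have i3 := (ha.intervalIntegrable_weakDeriv_sq hL).const_mul (1 / 2)
  have i4 := (hb.intervalIntegrable_weakDeriv_sq hL).const_mul (1 / 2)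
  rw [e1, ← intervalIntegral.integral_const_mul, ← intervalIntegral.integral_const_mul,
    ← intervalIntegral.integral_add i3 i4]
  refine intervalIntegral.integral_mono_on hL (intervalIntegrable_sq_of_memLp_two hL hm.memLp)
    (i3.add i4) fun x _ => ?_
  simp only [midpt]
  nlinarith [sq_nonneg (weakDeriv L a x - weakDeriv L b x)]

lemma dissipation_midpoint_le {L : ℝ} (hL : 0 ≤ L) {d : ℝ → ℝ} (hd : ContinuousOn d (Icc 0 1))
    {μ : ℝ} (hμ : StrongConvexOn (Icc 0 1) μ d) {a b : ℝ → ℝ} (ha : MemH1Unit L a)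
    (hb : MemH1Unit L b) :
    (∫ x in (0 : ℝ)..L, d (midpt a b x)) + μ / 8 * ∫ x in (0 : ℝ)..L, (a x - b x) ^ 2
      ≤ 1 / 2 * (∫ x in (0 : ℝ)..L, d (a x)) + 1 / 2 * ∫ x in (0 : ℝ)..L, d (b x) := by
  have i1 := intervalIntegrable_comp hL hd (ha.midpt hL hb)
  have i2 : IntervalIntegrable (fun x => μ / 8 * (a x - b x) ^ 2) volume 0 L :=
    (ContinuousOn.intervalIntegrable_of_Icc hL ((ha.1.1.sub hb.1.1).pow 2)).const_mul _
  have i3 := (intervalIntegrable_comp hL hd ha).const_mul (1 / 2)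
  have i4 := (intervalIntegrable_comp hL hd hb).const_mul (1 / 2)
  rw [← intervalIntegral.integral_const_mul, ← intervalIntegral.integral_const_mul,
    ← intervalIntegral.integral_const_mul, ← intervalIntegral.integral_add i1 i2,
    ← intervalIntegral.integral_add i3 i4]
  refine intervalIntegral.integral_mono_on hL (i1.add i2) (i3.add i4) fun x hx => ?_
  have := hμ.2 (ha.2 x hx) (hb.2 x hx) (by norm_num : (0 : ℝ) ≤ 1 / 2)
    (by norm_num : (0 : ℝ) ≤ 1 / 2) (by norm_num)
  simp only [smul_eq_mul, Real.norm_eq_abs, sq_abs] at this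
  simp only [midpt]
  linarith

lemma slip_continuousOn {L : ℝ} {u : Fin 2 → ℝ → ℝ} (hu : ∀ i, ContinuousOn (u i) (Icc 0 L)) :
    ContinuousOn (slip u) (Icc 0 L) := ((hu 0).sub (hu 1)).abs

lemma DensityAssumption.intervalIntegrable {φ : ℝ → ℝ → ℝ} {lam : ℝ} (h : DensityAssumption φ lam)
    {L : ℝ} (hL : 0 ≤ L) {δ γ : ℝ → ℝ} (hδ : ContinuousOn δ (Icc 0 L))
    (hγ : ContinuousOn γ (Icc 0 L)) (h0 : ∀ x ∈ Icc 0 L, 0 ≤ δ x)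
    (hle : ∀ x ∈ Icc 0 L, δ x ≤ γ x) :
    IntervalIntegrable (fun x => φ (δ x) (γ x)) volume 0 L :=
  (h.continuousOn.comp (hδ.prodMk hγ) fun x hx => ⟨h0 x hx, hle x hx⟩).intervalIntegrable_of_Icc hL

lemma DensityAssumption.intervalIntegrable_slip {φ : ℝ → ℝ → ℝ} {lam : ℝ}
    (h : DensityAssumption φ lam) {L : ℝ} (hL : 0 ≤ L) {u : Fin 2 → ℝ → ℝ}
    (hu : ∀ i, ContinuousOn (u i) (Icc 0 L)) {γ : ℝ → ℝ} (hγ : ContinuousOn γ (Icc 0 L)) :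
    IntervalIntegrable (fun x => φ (slip u x) (max (γ x) (slip u x))) volume 0 L :=
  h.intervalIntegrable hL (slip_continuousOn hu) (hγ.sup (slip_continuousOn hu))
    (fun _ _ => abs_nonneg _) fun _ _ => le_max_right _ _

lemma cohesiveEnergy_midpoint_le {L : ℝ} (hL : 0 ≤ L) {φ : ℝ → ℝ → ℝ} {lam : ℝ}
    (h : DensityAssumption φ lam) (hlam : 0 ≤ lam) {u v : Fin 2 → ℝ → ℝ}
    (hu : ∀ i, ContinuousOn (u i) (Icc 0 L)) (hv : ∀ i, ContinuousOn (v i) (Icc 0 L))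
    {γ : ℝ → ℝ} (hγ : ContinuousOn γ (Icc 0 L)) (hγ0 : ∀ x ∈ Icc 0 L, 0 ≤ γ x) :
    cohesiveEnergy L φ (slip fun i => midpt (u i) (v i))
        (fun x => max (γ x) (slip (fun i => midpt (u i) (v i)) x))
      ≤ 1 / 2 * cohesiveEnergy L φ (slip u) (fun x => max (γ x) (slip u x))
        + 1 / 2 * cohesiveEnergy L φ (slip v) (fun x => max (γ x) (slip v x))
        + lam / 8 * ∫ x in (0 : ℝ)..L, ((u 0 x - u 1 x) - (v 0 x - v 1 x)) ^ 2 := by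
  have hm : ∀ i, ContinuousOn (midpt (u i) (v i)) (Icc 0 L) := fun i =>
    ((hu i).const_mul _).add ((hv i).const_mul _)
  have i1 := h.intervalIntegrable_slip hL hm hγ
  have i2 := (h.intervalIntegrable_slip hL hu hγ).const_mul (1 / 2)
  have i3 := (h.intervalIntegrable_slip hL hv hγ).const_mul (1 / 2)
  have i4 : IntervalIntegrable (fun x => lam / 8 * ((u 0 x - u 1 x) - (v 0 x - v 1 x)) ^ 2)
      volume 0 L := (ContinuousOn.intervalIntegrable_of_Icc hL
    ((((hu 0).sub (hu 1)).sub ((hv 0).sub (hv 1))).pow 2)).const_mul _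
  unfold cohesiveEnergy
  rw [← intervalIntegral.integral_const_mul, ← intervalIntegral.integral_const_mul,
    ← intervalIntegral.integral_const_mul, ← intervalIntegral.integral_add i2 i3,
    ← intervalIntegral.integral_add (i2.add i3) i4]
  refine intervalIntegral.integral_mono_on hL i1 ((i2.add i3).add i4) fun x hx => ?_
  have := h.midpoint_le hlam (hγ0 x hx) (u 0 x - u 1 x) (v 0 x - v 1 x)
  have e1 : slip (fun i => midpt (u i) (v i)) x =
      |1 / 2 * (u 0 x - u 1 x) + 1 / 2 * (v 0 x - v 1 x)| := by
    simp only [slip, midpt]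
    congr 1
    ring
  beta_reduce
  rw [e1]
  exact this

/-- The signed slips vanish at both ends, since the two layers share their boundary values; so the
sharp Poincaré inequality applies to their difference. The factor `2` is the cost of `(a - b)² ≤ 2a²
+ 2b²`. -/
lemma integral_slip_sub_sq_le {L c : ℝ} (hL : 0 < L) {u v : Fin 2 → ℝ → ℝ}
    (hu : ∀ i, MemH1Bdry L c (u i)) (hv : ∀ i, MemH1Bdry L c (v i)) :
    ∫ x in (0 : ℝ)..L, ((u 0 x - u 1 x) - (v 0 x - v 1 x)) ^ 2 ≤ L ^ 2 / Real.pi ^ 2 *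
      (2 * ∑ i, ∫ x in (0 : ℝ)..L, (weakDeriv L (u i) x - weakDeriv L (v i) x) ^ 2) := by
  have h1 := ((hu 0).1.hasH1Deriv.linear_comb hL.le (hu 1).1.hasH1Deriv 1 (-1)).linear_comb hL.le
    ((hv 0).1.hasH1Deriv.linear_comb hL.le (hv 1).1.hasH1Deriv 1 (-1)) 1 (-1)
  have h2 := h1.integral_sq_le hL
    (by simp [(hu 0).2.1, (hu 1).2.1, (hv 0).2.1, (hv 1).2.1])
    (by simp [(hu 0).2.2, (hu 1).2.2, (hv 0).2.2, (hv 1).2.2])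
  have i0 := (hu 0).1.intervalIntegrable_weakDeriv_sub_sq hL.le (hv 0).1
  have i1 := (hu 1).1.intervalIntegrable_weakDeriv_sub_sq hL.le (hv 1).1
  rw [Fin.sum_univ_two, ← intervalIntegral.integral_add i0 i1,
    ← intervalIntegral.integral_const_mul]
  refine le_trans (le_of_eq ?_) (h2.trans ?_)
  · refine intervalIntegral.integral_congr fun x _ => ?_
    ring
  refine mul_le_mul_of_nonneg_left ?_ (by positivity)
  refine intervalIntegral.integral_mono_on hL.le (intervalIntegrable_sq_of_memLp_two hL.le h1.memLp)
    ((i0.add i1).const_mul 2) fun x _ => ?_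
  nlinarith [sq_nonneg ((weakDeriv L (u 0) x - weakDeriv L (v 0) x) +
    (weakDeriv L (u 1) x - weakDeriv L (v 1) x))]

/-- The squared distance in which the total energy is uniformly convex. -/
noncomputable def stateDist (L : ℝ) (u v α β : Fin 2 → ℝ → ℝ) : ℝ :=
  ∑ i, ((∫ x in (0 : ℝ)..L, (weakDeriv L (u i) x - weakDeriv L (v i) x) ^ 2)
    + ∫ x in (0 : ℝ)..L, (α i x - β i x) ^ 2)

lemma stateDist_nonneg {L : ℝ} (hL : 0 ≤ L) (u v α β : Fin 2 → ℝ → ℝ) :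
    0 ≤ stateDist L u v α β :=
  Finset.sum_nonneg fun _ _ => add_nonneg
    (intervalIntegral.integral_nonneg hL fun _ _ => sq_nonneg _)
    (intervalIntegral.integral_nonneg hL fun _ _ => sq_nonneg _)

lemma exists_totalEnergy_midpoint_le {L : ℝ} (hL : 0 < L) {E w : Fin 2 → ℝ → ℝ}
    {φ : ℝ → ℝ → ℝ} {lam : ℝ} (hlam : 0 < lam) (hE : ∀ i, ModulusAssumption (E i))
    (hw : ∀ i, DissipationAssumption (w i)) (hφ : DensityAssumption φ lam) {r : ℝ}
    (hr : lam * (L ^ 2 / Real.pi ^ 2) < r) (hrm : ∀ i, r < modulusm (E i) / modulusM (E i)) :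
    ∃ κ : ℝ, 0 < κ ∧ ∀ (c : ℝ) (u v α β : Fin 2 → ℝ → ℝ) (γ : ℝ → ℝ),
      (∀ i, MemH1Bdry L c (u i)) → (∀ i, MemH1Bdry L c (v i)) →
      (∀ i, MemH1Unit L (α i)) → (∀ i, MemH1Unit L (β i)) →
      ContinuousOn γ (Icc 0 L) → (∀ x ∈ Icc 0 L, 0 ≤ γ x) →
      totalEnergy L E w φ (fun i => midpt (u i) (v i)) (fun i => midpt (α i) (β i))
          (fun x => max (γ x) (slip (fun i => midpt (u i) (v i)) x)) + κ * stateDist L u v α β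
        ≤ 1 / 2 * totalEnergy L E w φ u α (fun x => max (γ x) (slip u x))
          + 1 / 2 * totalEnergy L E w φ v β (fun x => max (γ x) (slip v x)) := by
  choose μ hμ0 hμ using fun i => (hw i).uniformlyConvex
  have hr0 : 0 < r := lt_of_le_of_lt (by positivity) hr
  -- The elastic gain per layer is `½ · r/2`, while the cohesive defect `lam/8` becomes `lam/4 ·
  -- L²/π²` after Poincaré. The difference is the first bound on `κ`; the other two are the gains
  -- from the uniformly convex `w i`.
  obtain ⟨κ, hκ, h1, h2, h3⟩ : ∃ κ : ℝ, 0 < κ ∧ κ ≤ (r - lam * (L ^ 2 / Real.pi ^ 2)) / 4 ∧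
      κ ≤ μ 0 / 8 ∧ κ ≤ μ 1 / 8 := by
    refine ⟨min ((r - lam * (L ^ 2 / Real.pi ^ 2)) / 4) (min (μ 0 / 8) (μ 1 / 8)), ?_,
      min_le_left _ _, (min_le_right _ _).trans (min_le_left _ _),
      (min_le_right _ _).trans (min_le_right _ _)⟩
    have := hμ0 0
    have := hμ0 1
    have := sub_pos.2 hr
    positivity
  refine ⟨κ, hκ, fun c u v α β γ hu hv hα hβ hγ hγ0 => ?_⟩
  have hel := fun i => elastic_midpoint_le hL.le (hE i) hr0 (hrm i) (hu i).1 (hv i).1 (hα i) (hβ i)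
  have hgr := fun i => gradient_midpoint_le hL.le (hα i).1 (hβ i).1
  have hdi := fun i => dissipation_midpoint_le hL.le (hw i).contDiffOn.continuousOn (hμ i)
    (hα i) (hβ i)
  have hco := cohesiveEnergy_midpoint_le hL.le hφ hlam.le (fun i => (hu i).1.1)
    (fun i => (hv i).1.1) hγ hγ0
  have hpo := integral_slip_sub_sq_le hL hu hv
  have hpo' := mul_le_mul_of_nonneg_left hpo (by positivity : (0 : ℝ) ≤ lam / 8)
  have el0 := hel 0
  have el1 := hel 1
  have gr0 := hgr 0
  have gr1 := hgr 1
  have di0 := hdi 0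
  have di1 := hdi 1
  have n0 : 0 ≤ ∫ x in (0 : ℝ)..L, (weakDeriv L (u 0) x - weakDeriv L (v 0) x) ^ 2 :=
    intervalIntegral.integral_nonneg hL.le fun _ _ => sq_nonneg _
  have n1 : 0 ≤ ∫ x in (0 : ℝ)..L, (weakDeriv L (u 1) x - weakDeriv L (v 1) x) ^ 2 :=
    intervalIntegral.integral_nonneg hL.le fun _ _ => sq_nonneg _
  have n2 : 0 ≤ ∫ x in (0 : ℝ)..L, (α 0 x - β 0 x) ^ 2 :=
    intervalIntegral.integral_nonneg hL.le fun _ _ => sq_nonneg _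
  have n3 : 0 ≤ ∫ x in (0 : ℝ)..L, (α 1 x - β 1 x) ^ 2 :=
    intervalIntegral.integral_nonneg hL.le fun _ _ => sq_nonneg _
  have k0 := mul_le_mul_of_nonneg_right h1 n0
  have k1 := mul_le_mul_of_nonneg_right h1 n1
  have k2 := mul_le_mul_of_nonneg_right h2 n2
  have k3 := mul_le_mul_of_nonneg_right h3 n3
  simp only [totalEnergy, elasticEnergy, damageEnergy, stateDist, Fin.sum_univ_two] at hpo' hco ⊢
  linarith

/-- Global stability improved by uniform convexity. -/
lemma IsGeneralisedEnergeticEvolution.stable_add_le {T L : ℝ} (hL : 0 < L) {E w : Fin 2 → ℝ → ℝ}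
    {φ : ℝ → ℝ → ℝ} {lam : ℝ} (hlam : 0 < lam) (hE : ∀ i, ModulusAssumption (E i))
    (hw : ∀ i, DissipationAssumption (w i)) (hφ : DensityAssumption φ lam) {r : ℝ}
    (hr : lam * (L ^ 2 / Real.pi ^ 2) < r) (hrm : ∀ i, r < modulusm (E i) / modulusM (E i))
    {ubar : ℝ → ℝ} {u₀ α₀ : Fin 2 → ℝ → ℝ} {u α : ℝ → Fin 2 → ℝ → ℝ} {γ : ℝ → ℝ → ℝ}
    (h : IsGeneralisedEnergeticEvolution T L E w φ ubar u₀ α₀ u α γ) :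
    ∃ κ : ℝ, 0 < κ ∧ ∀ s ∈ Icc 0 T, ∀ v β : Fin 2 → ℝ → ℝ,
      (∀ i, MemH1Bdry L (ubar s) (v i)) → (∀ i, MemH1Unit L (β i)) →
      (∀ i, ∀ x ∈ Icc 0 L, α s i x ≤ β i x) →
      totalEnergy L E w φ (u s) (α s) (γ s) + κ * stateDist L (u s) v (α s) β
        ≤ totalEnergy L E w φ v β (fun x => max (γ s x) (slip v x)) := by
  obtain ⟨κ, hκ, hmid⟩ := exists_totalEnergy_midpoint_le hL hlam hE hw hφ hr hrm
  -- The midpoint is an admissible competitor, so its energy is at least that of the state at `s`.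
  -- Cancelling half of the latter in the midpoint inequality doubles `κ`.
  refine ⟨2 * κ, by positivity, fun s hs v β hv hβ hαβ => ?_⟩
  have hγ0 : ∀ x ∈ Icc 0 L, 0 ≤ γ s x := fun x hx =>
    (abs_nonneg _).trans (h.slip_le_history s hs x hx)
  have h1 := hmid (ubar s) (u s) v (α s) β (γ s) (h.displacement_mem s hs) hv (h.damage_mem s hs)
    hβ (h.history_continuous s hs) hγ0
  have h2 := h.globally_stable s hs (fun i => midpt (u s i) (v i)) (fun i => midpt (α s i) (β i))
    (fun i => (h.displacement_mem s hs i).midpt hL.le (hv i))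
    (fun i => ((h.damage_mem s hs i).midpt hL.le (hβ i)).1)
    (fun i x hx => ⟨by
      have := hαβ i x hx
      simp only [midpt]
      linarith, (((h.damage_mem s hs i).midpt hL.le (hβ i)).2 x hx).2⟩)
  have h3 : totalEnergy L E w φ (u s) (α s) (fun x => max (γ s x) (slip (u s) x)) =
      totalEnergy L E w φ (u s) (α s) (γ s) := by
    unfold totalEnergy cohesiveEnergy
    congr 1
    refine intervalIntegral.integral_congr fun x hx => ?_
    rw [uIcc_of_le hL.le] at hx
    simp only
    rw [max_eq_left (h.slip_le_history s hs x hx)]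
  rw [h3] at h1
  linarith

/-! ### A priori bounds -/

lemma exists_modulus_bounds {E : Fin 2 → ℝ → ℝ} (hE : ∀ i, ModulusAssumption (E i)) :
    ∃ M Λ : ℝ, 0 < M ∧ 0 < Λ ∧ (∀ i, ∀ y ∈ Icc (0 : ℝ) 1, |E i y| ≤ M) ∧
      ∀ i, ∀ y ∈ Icc (0 : ℝ) 1, ∀ z ∈ Icc (0 : ℝ) 1, |E i y - E i z| ≤ Λ * |y - z| := by
  choose M hM using fun i => isCompact_Icc.exists_bound_of_continuousOn
    (hE i).contDiffOn.continuousOn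
  choose K hK using fun i => ((hE i).contDiffOn.of_le (by norm_num : (1 : WithTop ℕ∞) ≤ 2)
    ).exists_lipschitzOnWith one_ne_zero (convex_Icc 0 1) isCompact_Icc
  have hMle : ∀ i, M i ≤ |M 0| + |M 1| := by
    intro i
    fin_cases i
    · exact (le_abs_self _).trans (le_add_of_nonneg_right (abs_nonneg _))
    · exact (le_abs_self _).trans (le_add_of_nonneg_left (abs_nonneg _))
  have hKle : ∀ i, (K i : ℝ) ≤ K 0 + K 1 := by
    intro i
    fin_cases i
    · exact le_add_of_nonneg_right (K 1).2
    · exact le_add_of_nonneg_left (K 0).2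
  refine ⟨|M 0| + |M 1| + 1, K 0 + K 1 + 1, by positivity, by positivity, fun i y hy => ?_,
    fun i y hy z hz => ?_⟩
  · have := hM i y hy
    rw [Real.norm_eq_abs] at this
    linarith [hMle i]
  · have := (hK i).dist_le_mul y hy z hz
    rw [Real.dist_eq, Real.dist_eq] at this
    refine this.trans (mul_le_mul_of_nonneg_right ?_ (abs_nonneg _))
    linarith [hKle i]

lemma abs_mul_le_add_div {η : ℝ} (hη : 0 < η) (a b : ℝ) : |a * b| ≤ η * b ^ 2 + a ^ 2 / η := by
  have h1 : a ^ 2 / η = η * (a / η) ^ 2 := by field_simp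
  have h2 : |a * b| = η * (|a / η| * |b|) := by
    rw [abs_mul, abs_div, abs_of_pos hη]; field_simp
  rw [h1, h2, ← mul_add, ← sq_abs b, ← sq_abs (a / η)]
  refine mul_le_mul_of_nonneg_left ?_ hη.le
  nlinarith [sq_nonneg (|a / η| - |b|), sq_nonneg (|a / η|), sq_nonneg (|b|)]

/-! ### Bounds and continuity for the integrated stress. -/

lemma intervalIntegrable_stress {L : ℝ} (hL : 0 ≤ L) {e u a : ℝ → ℝ}
    (he : ContinuousOn e (Icc 0 1)) (hu : MemH1 L u) (ha : MemH1Unit L a) :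
    IntervalIntegrable (stress L e u a) volume 0 L :=
  intervalIntegrable_comp_mul hL he ha (hu.intervalIntegrable_weakDeriv hL)

/-- The integrated stress of the two layers. -/
noncomputable def totalStress (L : ℝ) (E : Fin 2 → ℝ → ℝ) (u α : Fin 2 → ℝ → ℝ) : ℝ :=
  ∫ x in (0 : ℝ)..L, ∑ i, stress L (E i) (u i) (α i) x

lemma totalStress_eq {L : ℝ} (hL : 0 ≤ L) {E : Fin 2 → ℝ → ℝ} (hE : ∀ i, ModulusAssumption (E i))
    {u α : Fin 2 → ℝ → ℝ} (hu : ∀ i, MemH1 L (u i)) (hα : ∀ i, MemH1Unit L (α i)) :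
    totalStress L E u α = ∑ i, ∫ x in (0 : ℝ)..L, stress L (E i) (u i) (α i) x :=
  intervalIntegral.integral_finsetSum fun i _ =>
    intervalIntegrable_stress hL (hE i).contDiffOn.continuousOn (hu i) (hα i)

lemma abs_totalStress_le {L : ℝ} (hL : 0 ≤ L) {E : Fin 2 → ℝ → ℝ}
    (hE : ∀ i, ModulusAssumption (E i)) {M R : ℝ} (hM0 : 0 ≤ M)
    (hM : ∀ i, ∀ y ∈ Icc (0 : ℝ) 1, |E i y| ≤ M) {u α : Fin 2 → ℝ → ℝ}
    (hu : ∀ i, MemH1 L (u i)) (hα : ∀ i, MemH1Unit L (α i))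
    (hR : ∀ i, ∫ x in (0 : ℝ)..L, weakDeriv L (u i) x ^ 2 ≤ R) :
    |totalStress L E u α| ≤ 2 * (M * (L + R)) := by
  have key : ∀ i, |∫ x in (0 : ℝ)..L, stress L (E i) (u i) (α i) x| ≤ M * (L + R) := by
    intro i
    have i1 := intervalIntegrable_stress hL (hE i).contDiffOn.continuousOn (hu i) (hα i)
    have i2 := (hu i).intervalIntegrable_weakDeriv_sq hL
    have h1 : ∫ x in (0 : ℝ)..L, |stress L (E i) (u i) (α i) x| ≤
        ∫ x in (0 : ℝ)..L, M * (1 + weakDeriv L (u i) x ^ 2) := by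
      refine intervalIntegral.integral_mono_on hL i1.abs
        ((intervalIntegrable_const.add i2).const_mul M) fun x hx => ?_
      rw [stress, abs_mul]
      refine mul_le_mul (hM i _ ((hα i).2 x hx)) ?_ (abs_nonneg _) hM0
      nlinarith [sq_nonneg (|weakDeriv L (u i) x| - 1), sq_abs (weakDeriv L (u i) x)]
    rw [intervalIntegral.integral_const_mul,
      intervalIntegral.integral_add intervalIntegrable_const i2,
      intervalIntegral.integral_const] at h1
    refine (intervalIntegral.abs_integral_le_integral_abs hL).trans (h1.trans ?_)
    simp only [sub_zero, smul_eq_mul, mul_one]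
    have := hR i
    gcongr
  rw [totalStress_eq hL hE hu hα, Fin.sum_univ_two]
  linarith [abs_add_le (∫ x in (0 : ℝ)..L, stress L (E 0) (u 0) (α 0) x)
    (∫ x in (0 : ℝ)..L, stress L (E 1) (u 1) (α 1) x), key 0, key 1]

/-- Split `E(a)p - E(b)q = E(a)(p - q) + (E(a) - E(b))q` and apply Young's inequality with weight
`η` to each term. When `stateDist` is of order `η²`, the whole bound is of order `η`. -/
lemma abs_totalStress_sub_le {L : ℝ} (hL : 0 ≤ L) {E : Fin 2 → ℝ → ℝ}
    (hE : ∀ i, ModulusAssumption (E i)) {M Λ R : ℝ} (hM0 : 0 ≤ M) (hΛ0 : 0 ≤ Λ)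
    (hM : ∀ i, ∀ y ∈ Icc (0 : ℝ) 1, |E i y| ≤ M)
    (hΛ : ∀ i, ∀ y ∈ Icc (0 : ℝ) 1, ∀ z ∈ Icc (0 : ℝ) 1, |E i y - E i z| ≤ Λ * |y - z|)
    {u v α β : Fin 2 → ℝ → ℝ} (hu : ∀ i, MemH1 L (u i)) (hv : ∀ i, MemH1 L (v i))
    (hα : ∀ i, MemH1Unit L (α i)) (hβ : ∀ i, MemH1Unit L (β i))
    (hR : ∀ i, ∫ x in (0 : ℝ)..L, weakDeriv L (v i) x ^ 2 ≤ R) {η : ℝ} (hη : 0 < η) :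
    |totalStress L E u α - totalStress L E v β| ≤
      2 * (M * L + Λ * R) * η + (M + Λ) * stateDist L u v α β / η := by
  have key : ∀ i, |(∫ x in (0 : ℝ)..L, stress L (E i) (u i) (α i) x) -
      ∫ x in (0 : ℝ)..L, stress L (E i) (v i) (β i) x| ≤ (M * L + Λ * R) * η + (M + Λ) *
        ((∫ x in (0 : ℝ)..L, (weakDeriv L (u i) x - weakDeriv L (v i) x) ^ 2)
          + ∫ x in (0 : ℝ)..L, (α i x - β i x) ^ 2) / η := by
    intro i
    have i1 := intervalIntegrable_stress hL (hE i).contDiffOn.continuousOn (hu i) (hα i)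
    have i2 := intervalIntegrable_stress hL (hE i).contDiffOn.continuousOn (hv i) (hβ i)
    have i3 := (hu i).intervalIntegrable_weakDeriv_sub_sq hL (hv i)
    have i4 := (hv i).intervalIntegrable_weakDeriv_sq hL
    have i5 : IntervalIntegrable (fun x => (α i x - β i x) ^ 2) volume 0 L :=
      ContinuousOn.intervalIntegrable_of_Icc hL (((hα i).1.1.sub (hβ i).1.1).pow 2)
    have h1 : ∫ x in (0 : ℝ)..L, |stress L (E i) (u i) (α i) x - stress L (E i) (v i) (β i) x| ≤
        ∫ x in (0 : ℝ)..L, ((M * η + M / η * (weakDeriv L (u i) x - weakDeriv L (v i) x) ^ 2)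
          + (Λ * η * weakDeriv L (v i) x ^ 2 + Λ / η * (α i x - β i x) ^ 2)) := by
      refine intervalIntegral.integral_mono_on hL (i1.sub i2).abs
        ((intervalIntegrable_const.add (i3.const_mul _)).add
          ((i4.const_mul _).add (i5.const_mul _))) fun x hx => ?_
      set p := weakDeriv L (u i) x
      set q := weakDeriv L (v i) x
      set a := α i x
      set b := β i x
      have e1 : stress L (E i) (u i) (α i) x - stress L (E i) (v i) (β i) x =
          E i a * (p - q) + (E i a - E i b) * q := by simp only [stress]; ring
      rw [e1]
      have h2 : |E i a * (p - q)| ≤ M * (η + (p - q) ^ 2 / η) := by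
        rw [abs_mul]
        refine mul_le_mul (hM i _ ((hα i).2 x hx)) ?_ (abs_nonneg _) hM0
        simpa using abs_mul_le_add_div hη (p - q) 1
      have h3 : |(E i a - E i b) * q| ≤ Λ * (η * q ^ 2 + (a - b) ^ 2 / η) := by
        rw [abs_mul]
        refine (mul_le_mul_of_nonneg_right (hΛ i _ ((hα i).2 x hx) _ ((hβ i).2 x hx))
          (abs_nonneg _)).trans ?_
        rw [mul_assoc, ← abs_mul]
        exact mul_le_mul_of_nonneg_left (abs_mul_le_add_div hη (a - b) q) hΛ0
      refine (abs_add_le _ _).trans ((add_le_add h2 h3).trans (le_of_eq ?_))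
      ring
    rw [intervalIntegral.integral_add (intervalIntegrable_const.add (i3.const_mul _))
        ((i4.const_mul _).add (i5.const_mul _)),
      intervalIntegral.integral_add intervalIntegrable_const (i3.const_mul _),
      intervalIntegral.integral_add (i4.const_mul _) (i5.const_mul _),
      intervalIntegral.integral_const, intervalIntegral.integral_const_mul,
      intervalIntegral.integral_const_mul, intervalIntegral.integral_const_mul] at h1
    rw [← intervalIntegral.integral_sub i1 i2]
    refine (intervalIntegral.abs_integral_le_integral_abs hL).trans (h1.trans ?_)
    have n3 : 0 ≤ ∫ x in (0 : ℝ)..L, (weakDeriv L (u i) x - weakDeriv L (v i) x) ^ 2 :=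
      intervalIntegral.integral_nonneg hL fun _ _ => sq_nonneg _
    have n5 : 0 ≤ ∫ x in (0 : ℝ)..L, (α i x - β i x) ^ 2 :=
      intervalIntegral.integral_nonneg hL fun _ _ => sq_nonneg _
    have h4 := mul_le_mul_of_nonneg_left (hR i) (by positivity : 0 ≤ Λ * η)
    set X := ∫ x in (0 : ℝ)..L, (weakDeriv L (u i) x - weakDeriv L (v i) x) ^ 2
    set Y := ∫ x in (0 : ℝ)..L, (α i x - β i x) ^ 2
    have h5 : (M + Λ) * (X + Y) / η = M / η * X + Λ / η * Y + (Λ / η * X + M / η * Y) := by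
      ring
    have h6 : 0 ≤ Λ / η * X + M / η * Y := by positivity
    rw [h5]
    simp only [sub_zero, smul_eq_mul]
    linarith
  rw [totalStress_eq hL hE hu hα, totalStress_eq hL hE hv hβ, stateDist, Fin.sum_univ_two,
    Fin.sum_univ_two, Fin.sum_univ_two]
  have h0 := key 0
  have h1 := key 1
  refine (le_trans (le_of_eq ?_) ((abs_add_le _ _).trans (add_le_add h0 h1))).trans (le_of_eq ?_)
  · congr 1; ring
  · ring

/-- Coercivity: `E_i > 2r`, and every other contribution to the energy is non-negative. -/
lemma mul_integral_weakDeriv_sq_le_totalEnergy {L : ℝ} (hL : 0 ≤ L) {E w : Fin 2 → ℝ → ℝ}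
    {φ : ℝ → ℝ → ℝ} {lam : ℝ} (hE : ∀ i, ModulusAssumption (E i))
    (hw : ∀ i, DissipationAssumption (w i)) (hφ : DensityAssumption φ lam) {r : ℝ} (hr : 0 < r)
    (hrm : ∀ i, r < modulusm (E i) / modulusM (E i)) {u α : Fin 2 → ℝ → ℝ} {γ : ℝ → ℝ}
    (hu : ∀ i, MemH1 L (u i)) (hα : ∀ i, MemH1Unit L (α i))
    (hγ : ∀ x ∈ Icc 0 L, slip u x ≤ γ x) (i : Fin 2) :
    r * ∫ x in (0 : ℝ)..L, weakDeriv L (u i) x ^ 2 ≤ totalEnergy L E w φ u α γ := by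
  have h1 : ∀ i, r * ∫ x in (0 : ℝ)..L, weakDeriv L (u i) x ^ 2 ≤
      1 / 2 * ∫ x in (0 : ℝ)..L, E i (α i x) * weakDeriv L (u i) x ^ 2 := by
    intro i
    have i1 := (hu i).intervalIntegrable_weakDeriv_sq hL
    rw [← intervalIntegral.integral_const_mul, ← intervalIntegral.integral_const_mul]
    refine intervalIntegral.integral_mono_on hL (i1.const_mul _)
      ((intervalIntegrable_comp_mul hL (hE i).contDiffOn.continuousOn (hα i) i1).const_mul _)
      fun x hx => ?_
    have := (hE i).two_mul_lt hr (hrm i) ((hα i).2 x hx)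
    nlinarith [sq_nonneg (weakDeriv L (u i) x)]
  have h2 : ∀ i, 0 ≤ r * ∫ x in (0 : ℝ)..L, weakDeriv L (u i) x ^ 2 := fun i =>
    mul_nonneg hr.le (intervalIntegral.integral_nonneg hL fun _ _ => sq_nonneg _)
  have h3 : ∀ i, 0 ≤ ∫ x in (0 : ℝ)..L, weakDeriv L (α i) x ^ 2 := fun i =>
    intervalIntegral.integral_nonneg hL fun _ _ => sq_nonneg _
  have h4 : ∀ i, 0 ≤ ∫ x in (0 : ℝ)..L, w i (α i x) := fun i =>
    intervalIntegral.integral_nonneg hL fun x hx => (hw i).nonneg _ ((hα i).2 x hx)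
  have h5 : 0 ≤ cohesiveEnergy L φ (slip u) γ :=
    intervalIntegral.integral_nonneg hL fun x hx => hφ.nonneg (slip u x, γ x)
      ⟨abs_nonneg _, hγ x hx⟩
  have e0 := h1 0
  have e1 := h1 1
  have n0 := h2 0
  have n1 := h2 1
  have := h3 0
  have := h3 1
  have := h4 0
  have := h4 1
  simp only [totalEnergy, elasticEnergy, damageEnergy, Fin.sum_univ_two]
  fin_cases i <;> simp only [Fin.zero_eta, Fin.mk_one] <;> linarith

lemma intervalIntegrable_of_integrableOn_Ioo {T : ℝ} (hT : 0 ≤ T) {f : ℝ → ℝ}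
    (hf : IntegrableOn f (Ioo 0 T)) {s t : ℝ} (hs : s ∈ Icc 0 T) (ht : t ∈ Icc 0 T) :
    IntervalIntegrable f volume s t := by
  rw [← intervalIntegrable_iff_integrableOn_Ioo_of_le hT] at hf
  exact hf.mono_set (by rw [uIcc_of_le hT]; exact uIcc_subset_Icc hs ht)

lemma IsGeneralisedEnergeticEvolution.exists_bound {T L : ℝ} (hT : 0 ≤ T) (hL : 0 ≤ L)
    {E w : Fin 2 → ℝ → ℝ} {φ : ℝ → ℝ → ℝ} {lam : ℝ} (hE : ∀ i, ModulusAssumption (E i))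
    (hw : ∀ i, DissipationAssumption (w i)) (hφ : DensityAssumption φ lam) {r : ℝ}
    (hr : 0 < r) (hrm : ∀ i, r < modulusm (E i) / modulusM (E i))
    {ubar : ℝ → ℝ} {u₀ α₀ : Fin 2 → ℝ → ℝ} {u α : ℝ → Fin 2 → ℝ → ℝ} {γ : ℝ → ℝ → ℝ}
    (h : IsGeneralisedEnergeticEvolution T L E w φ ubar u₀ α₀ u α γ) :
    ∃ R : ℝ, 0 ≤ R ∧ ∀ t ∈ Icc 0 T, ∀ i, ∫ x in (0 : ℝ)..L, weakDeriv L (u t i) x ^ 2 ≤ R := by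
  set P := power L E ubar u α with hP
  set R := (totalEnergy L E w φ u₀ α₀ (slip u₀) + ∫ τ in (0 : ℝ)..T, |P τ|) / r with hRdef
  have key : ∀ t ∈ Icc 0 T, ∀ i, ∫ x in (0 : ℝ)..L, weakDeriv L (u t i) x ^ 2 ≤ R := by
    intro t ht i
    rw [hRdef, le_div_iff₀ hr, mul_comm]
    refine (mul_integral_weakDeriv_sq_le_totalEnergy hL hE hw hφ hr hrm
      (fun i => (h.displacement_mem t ht i).1) (h.damage_mem t ht) (h.slip_le_history t ht)
      i).trans ?_
    rw [h.energy_balance t ht, work]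
    have h0 : (0 : ℝ) ∈ Icc 0 T := ⟨le_rfl, hT⟩
    have h1 := intervalIntegral.abs_integral_le_integral_abs (f := P) (μ := volume) ht.1
    have h2 : ∫ τ in (0 : ℝ)..t, |P τ| ≤ ∫ τ in (0 : ℝ)..T, |P τ| :=
      intervalIntegral.integral_mono_interval le_rfl ht.1 ht.2
        (Filter.Eventually.of_forall fun τ => abs_nonneg _)
        (intervalIntegrable_of_integrableOn_Ioo hT h.power_integrable h0 ⟨hT, le_rfl⟩).abs
    have h3 := le_abs_self (∫ τ in (0 : ℝ)..t, P τ)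
    linarith
  refine ⟨R, ?_, key⟩
  exact (intervalIntegral.integral_nonneg hL fun _ _ => sq_nonneg _).trans
    (key 0 ⟨le_rfl, hT⟩ 0)

/-! ### Estimates in time -/

/-- Subtraction of the affine function with slope `k` from both layers. -/
def shear (k : ℝ) (u : Fin 2 → ℝ → ℝ) (i : Fin 2) (x : ℝ) : ℝ := u i x - k * x

lemma hasH1Deriv_shear {L : ℝ} (hL : 0 ≤ L) {u : Fin 2 → ℝ → ℝ} (k : ℝ) {i : Fin 2}
    (hu : MemH1 L (u i)) : HasH1Deriv L (shear k u i) (fun x => weakDeriv L (u i) x - k) := by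
  have := hu.hasH1Deriv.linear_comb hL (hasH1Deriv_mul_const hL k) 1 (-1)
  simp only [one_mul, neg_one_mul, ← sub_eq_add_neg] at this
  exact this

lemma slip_shear (k : ℝ) (u : Fin 2 → ℝ → ℝ) : slip (shear k u) = slip u := by
  funext x
  simp only [slip, shear, sub_sub_sub_cancel_right]

/-- This turns a state at one time into an admissible competitor at another; by `slip_shear` the
cohesive energy does not notice the change. -/
lemma memH1Bdry_shear {L a b : ℝ} (hL : 0 < L) {u : Fin 2 → ℝ → ℝ} {i : Fin 2}
    (hu : MemH1Bdry L b (u i)) : MemH1Bdry L a (shear ((b - a) / L) u i) :=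
  ⟨(hasH1Deriv_shear hL.le _ hu.1).memH1, by simp [shear, hu.2.1], by
    rw [shear, hu.2.2, div_mul_cancel₀ _ hL.ne']; ring⟩

/-- Expand the square: the coefficient of `-k` is the total stress, and each layer contributes at
most `½ M L k²`. -/
lemma elasticEnergy_shear_le {L : ℝ} (hL : 0 ≤ L) {E : Fin 2 → ℝ → ℝ}
    (hE : ∀ i, ModulusAssumption (E i)) {M : ℝ}
    (hM : ∀ i, ∀ y ∈ Icc (0 : ℝ) 1, |E i y| ≤ M) {u α : Fin 2 → ℝ → ℝ}
    (hu : ∀ i, MemH1 L (u i)) (hα : ∀ i, MemH1Unit L (α i)) (k : ℝ) :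
    elasticEnergy L E (shear k u) α ≤
      elasticEnergy L E u α - k * totalStress L E u α + M * L * k ^ 2 := by
  have key : ∀ i, ∫ x in (0 : ℝ)..L, E i (α i x) * weakDeriv L (shear k u i) x ^ 2 ≤
      (∫ x in (0 : ℝ)..L, E i (α i x) * weakDeriv L (u i) x ^ 2)
        - 2 * k * (∫ x in (0 : ℝ)..L, stress L (E i) (u i) (α i) x) + M * L * k ^ 2 := by
    intro i
    have hsh := hasH1Deriv_shear hL k (hu i)
    have hc := (hE i).contDiffOn.continuousOn
    have e1 : ∫ x in (0 : ℝ)..L, E i (α i x) * weakDeriv L (shear k u i) x ^ 2 =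
        ∫ x in (0 : ℝ)..L, E i (α i x) * (weakDeriv L (u i) x - k) ^ 2 := by
      refine integral_congr_ae_Ioo hL ?_
      filter_upwards [hsh.weakDeriv_ae hL] with x hx hxL
      rw [hx hxL]
    have i1 := intervalIntegrable_comp_mul hL hc (hα i) ((hu i).intervalIntegrable_weakDeriv_sq hL)
    have i2 := (intervalIntegrable_stress hL hc (hu i) (hα i)).const_mul (2 * k)
    have i3 := (intervalIntegrable_comp hL hc (hα i)).const_mul (k ^ 2)
    have e2 : ∫ x in (0 : ℝ)..L, E i (α i x) * (weakDeriv L (u i) x - k) ^ 2 =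
        (∫ x in (0 : ℝ)..L, E i (α i x) * weakDeriv L (u i) x ^ 2)
        - 2 * k * (∫ x in (0 : ℝ)..L, stress L (E i) (u i) (α i) x)
        + k ^ 2 * ∫ x in (0 : ℝ)..L, E i (α i x) := by
      rw [← intervalIntegral.integral_const_mul, ← intervalIntegral.integral_const_mul,
        ← intervalIntegral.integral_sub i1 i2, ← intervalIntegral.integral_add (i1.sub i2) i3]
      refine intervalIntegral.integral_congr fun x _ => ?_
      simp only [stress]
      ring
    have h1 : ∫ x in (0 : ℝ)..L, E i (α i x) ≤ M * L := by
      have := intervalIntegral.integral_mono_on hL (intervalIntegrable_comp hL hc (hα i))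
        (intervalIntegrable_const (c := M)) fun x hx =>
          (le_abs_self _).trans (hM i _ ((hα i).2 x hx))
      rw [intervalIntegral.integral_const, smul_eq_mul, sub_zero] at this
      linarith
    rw [e1, e2]
    have := mul_le_mul_of_nonneg_left h1 (sq_nonneg k)
    linarith
  have h0 := key 0
  have h1 := key 1
  rw [totalStress_eq hL hE hu hα]
  simp only [elasticEnergy, Fin.sum_univ_two]
  linarith

lemma stateDist_le_shear {L : ℝ} (hL : 0 ≤ L) {u v α β : Fin 2 → ℝ → ℝ}
    (hu : ∀ i, MemH1 L (u i)) (hv : ∀ i, MemH1 L (v i)) (k : ℝ) :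
    stateDist L u v α β ≤ 2 * stateDist L u (shear k v) α β + 4 * L * k ^ 2 := by
  have key : ∀ i, ∫ x in (0 : ℝ)..L, (weakDeriv L (u i) x - weakDeriv L (v i) x) ^ 2 ≤
      2 * (∫ x in (0 : ℝ)..L, (weakDeriv L (u i) x - weakDeriv L (shear k v i) x) ^ 2)
        + 2 * L * k ^ 2 := by
    intro i
    have hsh := hasH1Deriv_shear hL k (hv i)
    have e1 : ∫ x in (0 : ℝ)..L, (weakDeriv L (u i) x - weakDeriv L (shear k v i) x) ^ 2 =
        ∫ x in (0 : ℝ)..L, (weakDeriv L (u i) x - (weakDeriv L (v i) x - k)) ^ 2 := by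
      refine integral_congr_ae_Ioo hL ?_
      filter_upwards [hsh.weakDeriv_ae hL] with x hx hxL
      rw [hx hxL]
    have i1 := (hu i).intervalIntegrable_weakDeriv_sub_sq hL (hv i)
    have i2 := (intervalIntegrable_sq_of_memLp_two hL ((hu i).memLp.sub hsh.memLp)).const_mul 2
    have h1 := intervalIntegral.integral_mono_on hL i1
      (i2.add (intervalIntegrable_const (c := 2 * k ^ 2))) fun x _ => by
        simp only [Pi.sub_apply]
        nlinarith [sq_nonneg (weakDeriv L (u i) x - (weakDeriv L (v i) x - k) + k)]
    rw [intervalIntegral.integral_add i2 intervalIntegrable_const,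
      intervalIntegral.integral_const_mul, intervalIntegral.integral_const, smul_eq_mul,
      sub_zero] at h1
    rw [e1]
    refine h1.trans (le_of_eq ?_)
    simp only [Pi.sub_apply]
    ring
  have n0 : 0 ≤ ∫ x in (0 : ℝ)..L, (α 0 x - β 0 x) ^ 2 :=
    intervalIntegral.integral_nonneg hL fun _ _ => sq_nonneg _
  have n1 : 0 ≤ ∫ x in (0 : ℝ)..L, (α 1 x - β 1 x) ^ 2 :=
    intervalIntegral.integral_nonneg hL fun _ _ => sq_nonneg _
  have h0 := key 0
  have h1 := key 1
  simp only [stateDist, Fin.sum_univ_two]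
  linarith

/-- The cohesive energy dissipated between the times `s` and `t` by the growth of the history
variable beyond the slip. -/
noncomputable def cohesiveGap (L : ℝ) (φ : ℝ → ℝ → ℝ) (u : ℝ → Fin 2 → ℝ → ℝ) (γ : ℝ → ℝ → ℝ)
    (s t : ℝ) : ℝ :=
  cohesiveEnergy L φ (slip (u t)) (γ t)
    - cohesiveEnergy L φ (slip (u t)) (fun x => max (γ s x) (slip (u t) x))

section Evolution

variable {T L : ℝ} {E w : Fin 2 → ℝ → ℝ} {φ : ℝ → ℝ → ℝ} {lam : ℝ} {ubar : ℝ → ℝ}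
  {u₀ α₀ : Fin 2 → ℝ → ℝ} {u α : ℝ → Fin 2 → ℝ → ℝ} {γ : ℝ → ℝ → ℝ}

lemma IsGeneralisedEnergeticEvolution.cohesive_integrand_le
    (h : IsGeneralisedEnergeticEvolution T L E w φ ubar u₀ α₀ u α γ)
    (hφ : DensityAssumption φ lam) (hmono : UniformStrictMono φ) {s t : ℝ} (hs : 0 ≤ s)
    (hst : s ≤ t) (ht : t ≤ T) {x : ℝ} (hx : x ∈ Icc 0 L) :
    φ (slip (u t) x) (max (γ s x) (slip (u t) x)) ≤ φ (slip (u t) x) (γ t x) :=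
  hφ.mono_right hmono (abs_nonneg _) (le_max_right _ _)
    (max_le (h.history_mono s t hs hst ht x hx) (h.slip_le_history t ⟨hs.trans hst, ht⟩ x hx))

lemma IsGeneralisedEnergeticEvolution.cohesiveGap_eq
    (h : IsGeneralisedEnergeticEvolution T L E w φ ubar u₀ α₀ u α γ) (hL : 0 ≤ L)
    (hφ : DensityAssumption φ lam) {s t : ℝ} (hs : s ∈ Icc 0 T) (ht : t ∈ Icc 0 T) :
    IntervalIntegrable (fun x => φ (slip (u t) x) (γ t x)
        - φ (slip (u t) x) (max (γ s x) (slip (u t) x))) volume 0 L ∧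
      cohesiveGap L φ u γ s t = ∫ x in (0 : ℝ)..L, (φ (slip (u t) x) (γ t x)
        - φ (slip (u t) x) (max (γ s x) (slip (u t) x))) := by
  have hu : ∀ i, ContinuousOn (u t i) (Icc 0 L) := fun i => (h.displacement_mem t ht i).1.1
  have i1 := hφ.intervalIntegrable hL (slip_continuousOn hu) (h.history_continuous t ht)
    (fun _ _ => abs_nonneg _) (h.slip_le_history t ht)
  have i2 := hφ.intervalIntegrable_slip hL hu (h.history_continuous s hs)
  exact ⟨i1.sub i2, (intervalIntegral.integral_sub i1 i2).symm⟩

lemma IsGeneralisedEnergeticEvolution.cohesiveGap_nonneg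
    (h : IsGeneralisedEnergeticEvolution T L E w φ ubar u₀ α₀ u α γ) (hL : 0 ≤ L)
    (hφ : DensityAssumption φ lam) (hmono : UniformStrictMono φ) {s t : ℝ} (hs : 0 ≤ s)
    (hst : s ≤ t) (ht : t ≤ T) : 0 ≤ cohesiveGap L φ u γ s t := by
  rw [(h.cohesiveGap_eq hL hφ ⟨hs, hst.trans ht⟩ ⟨hs.trans hst, ht⟩).2]
  exact intervalIntegral.integral_nonneg hL fun x hx =>
    sub_nonneg.2 (h.cohesive_integrand_le hφ hmono hs hst ht hx)

/-- The sheared state at `t` is tested in the improved stability at `s`, with damage `α t`,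
admissible by irreversibility. The energy balance turns the energy increment into work, and what the
competitor saves in cohesive energy by carrying the older history is the gap. -/
lemma IsGeneralisedEnergeticEvolution.cohesiveGap_add_le
    (h : IsGeneralisedEnergeticEvolution T L E w φ ubar u₀ α₀ u α γ) (hL : 0 < L)
    (hE : ∀ i, ModulusAssumption (E i)) {M κ : ℝ}
    (hM : ∀ i, ∀ y ∈ Icc (0 : ℝ) 1, |E i y| ≤ M)
    (hstab : ∀ s ∈ Icc 0 T, ∀ v β : Fin 2 → ℝ → ℝ,
      (∀ i, MemH1Bdry L (ubar s) (v i)) → (∀ i, MemH1Unit L (β i)) →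
      (∀ i, ∀ x ∈ Icc 0 L, α s i x ≤ β i x) →
      totalEnergy L E w φ (u s) (α s) (γ s) + κ * stateDist L (u s) v (α s) β
        ≤ totalEnergy L E w φ v β (fun x => max (γ s x) (slip v x)))
    {s t : ℝ} (hs : 0 ≤ s) (hst : s ≤ t) (ht : t ≤ T) :
    cohesiveGap L φ u γ s t
        + κ * stateDist L (u s) (shear ((ubar t - ubar s) / L) (u t)) (α s) (α t) ≤
      (∫ τ in s..t, power L E ubar u α τ)
        - (ubar t - ubar s) / L * totalStress L E (u t) (α t)
        + M * L * ((ubar t - ubar s) / L) ^ 2 := by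
  have hsT : s ∈ Icc 0 T := ⟨hs, hst.trans ht⟩
  have htT : t ∈ Icc 0 T := ⟨hs.trans hst, ht⟩
  have hT : 0 ≤ T := htT.1.trans htT.2
  have h0T : (0 : ℝ) ∈ Icc 0 T := ⟨le_rfl, hT⟩
  set k := (ubar t - ubar s) / L
  have h1 := hstab s hsT (shear k (u t)) (α t)
    (fun i => memH1Bdry_shear hL (h.displacement_mem t htT i)) (h.damage_mem t htT)
    (fun i x hx => h.damage_mono i s t hs hst ht x hx)
  have h2 := elasticEnergy_shear_le hL.le hE hM (fun i => (h.displacement_mem t htT i).1)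
    (h.damage_mem t htT) k
  have h3 : totalEnergy L E w φ (u t) (α t) (γ t) - totalEnergy L E w φ (u s) (α s) (γ s) =
      ∫ τ in s..t, power L E ubar u α τ := by
    rw [h.energy_balance t htT, h.energy_balance s hsT, add_sub_add_left_eq_sub, work, work,
      intervalIntegral.integral_interval_sub_left
        (intervalIntegrable_of_integrableOn_Ioo hT h.power_integrable h0T htT)
        (intervalIntegrable_of_integrableOn_Ioo hT h.power_integrable h0T hsT)]
  simp only [slip_shear] at h1
  have h4 : totalEnergy L E w φ (shear k (u t)) (α t) (fun x => max (γ s x) (slip (u t) x)) =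
      elasticEnergy L E (shear k (u t)) (α t) + damageEnergy L w (α t) +
        cohesiveEnergy L φ (slip (u t)) (fun x => max (γ s x) (slip (u t) x)) := by
    rw [totalEnergy, slip_shear]
  have h5 : totalEnergy L E w φ (u t) (α t) (γ t) = elasticEnergy L E (u t) (α t)
      + damageEnergy L w (α t) + cohesiveEnergy L φ (slip (u t)) (γ t) := rfl
  unfold cohesiveGap
  linarith

/-- The cohesive gap is of higher order with respect to the variation of the prescribed
displacement. -/
lemma IsGeneralisedEnergeticEvolution.exists_cohesiveGap_le
    (h : IsGeneralisedEnergeticEvolution T L E w φ ubar u₀ α₀ u α γ) (hT : 0 ≤ T) (hL : 0 < L)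
    (hlam : 0 < lam) (hE : ∀ i, ModulusAssumption (E i))
    (hw : ∀ i, DissipationAssumption (w i)) (hφ : DensityAssumption φ lam)
    (hmono : UniformStrictMono φ) {r : ℝ} (hr : lam * (L ^ 2 / Real.pi ^ 2) < r)
    (hrm : ∀ i, r < modulusm (E i) / modulusM (E i))
    (hubar : AbsolutelyContinuousOnInterval ubar 0 T) :
    ∃ C : ℝ, 0 ≤ C ∧ ∀ η : ℝ, 0 < η → η ≤ 1 → ∀ s t, 0 ≤ s → s ≤ t → t ≤ T →
      ∫ τ in s..t, |deriv ubar τ| ≤ η ^ 2 →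
      cohesiveGap L φ u γ s t ≤ C * η * ∫ τ in s..t, |deriv ubar τ| := by
  have hr0 : 0 < r := lt_of_le_of_lt (by positivity) hr
  obtain ⟨κ, hκ, hstab⟩ := h.stable_add_le hL hlam hE hw hφ hr hrm
  obtain ⟨M, Λ, hM0, hΛ0, hM, hΛ⟩ := exists_modulus_bounds hE
  obtain ⟨R, hR0, hR⟩ := h.exists_bound hT hL.le hE hw hφ hr0 hrm
  have hmem : ∀ t ∈ Icc 0 T, ∀ i, MemH1 L (u t i) := fun t ht i => (h.displacement_mem t ht i).1
  set S := fun τ => totalStress L E (u τ) (α τ) with hS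
  set A := fun s t => ∫ τ in s..t, |deriv ubar τ| with hA
  set S₀ := 2 * (M * (L + R)) with hS₀
  have hS₀0 : 0 ≤ S₀ := by positivity
  have hSb : ∀ τ ∈ Icc 0 T, |S τ| ≤ S₀ := fun τ hτ =>
    abs_totalStress_le hL.le hE hM0.le hM (hmem τ hτ) (h.damage_mem τ hτ) (hR τ hτ)
  have hdi : ∀ s ∈ Icc 0 T, ∀ t ∈ Icc 0 T, IntervalIntegrable (deriv ubar) volume s t :=
    fun s hs t ht => hubar.intervalIntegrable_deriv.mono_set (by
      rw [uIcc_of_le hT]; exact uIcc_subset_Icc hs ht)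
  have hΔ : ∀ s ∈ Icc 0 T, ∀ t ∈ Icc 0 T, ubar t - ubar s = ∫ τ in s..t, deriv ubar τ :=
    fun s hs t ht => ((hubar.mono (by
      rw [uIcc_of_le hT]; exact uIcc_subset_Icc hs ht)).integral_deriv_eq_sub).symm
  have hA0 : ∀ s t, s ≤ t → 0 ≤ A s t := fun s t hst =>
    intervalIntegral.integral_nonneg hst fun _ _ => abs_nonneg _
  have hΔA : ∀ s ∈ Icc 0 T, ∀ t ∈ Icc 0 T, s ≤ t → |ubar t - ubar s| ≤ A s t :=
    fun s hs t ht hst => by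
      rw [hΔ s hs t ht]; exact intervalIntegral.abs_integral_le_integral_abs hst
  have hAmono : ∀ s τ t, 0 ≤ s → s ≤ τ → τ ≤ t → t ≤ T → A τ t ≤ A s t :=
    fun s τ t h0 h1 h2 h3 => intervalIntegral.integral_mono_interval h1 h2 le_rfl
      (Filter.Eventually.of_forall fun _ => abs_nonneg _)
      (hdi s ⟨h0, h1.trans (h2.trans h3)⟩ t ⟨h0.trans (h1.trans h2), h3⟩).abs
  have hPi : ∀ s ∈ Icc 0 T, ∀ t ∈ Icc 0 T,
      IntervalIntegrable (power L E ubar u α) volume s t := fun s hs t ht =>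
    intervalIntegrable_of_integrableOn_Ioo hT h.power_integrable hs ht
  -- the work done minus its frozen-stress approximation
  have hwork : ∀ s t, 0 ≤ s → s ≤ t → t ≤ T → ∀ B : ℝ, (∀ τ ∈ Icc s t, |S τ - S t| ≤ B) →
      (∫ τ in s..t, power L E ubar u α τ) - (ubar t - ubar s) / L * S t ≤ B / L * A s t := by
    intro s t hs hst ht B hB
    have hsT : s ∈ Icc 0 T := ⟨hs, hst.trans ht⟩
    have htT : t ∈ Icc 0 T := ⟨hs.trans hst, ht⟩
    have i1 := hdi s hsT t htT
    have e1 : (ubar t - ubar s) / L * S t = ∫ τ in s..t, S t / L * deriv ubar τ := by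
      rw [intervalIntegral.integral_const_mul, ← hΔ s hsT t htT]; ring
    rw [e1, ← intervalIntegral.integral_sub (hPi s hsT t htT) (i1.const_mul _), hA]
    simp only
    rw [← intervalIntegral.integral_const_mul]
    refine intervalIntegral.integral_mono_on hst ((hPi s hsT t htT).sub (i1.const_mul _))
      (i1.abs.const_mul _) fun τ hτ => ?_
    have e2 : power L E ubar u α τ - S t / L * deriv ubar τ =
        deriv ubar τ / L * (S τ - S t) := by
      simp only [power, hS, totalStress]; ring
    rw [e2]
    calc deriv ubar τ / L * (S τ - S t) ≤ |deriv ubar τ / L * (S τ - S t)| := le_abs_self _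
      _ = |deriv ubar τ| / L * |S τ - S t| := by rw [abs_mul, abs_div, abs_of_pos hL]
      _ ≤ |deriv ubar τ| / L * B := by gcongr; exact hB τ hτ
      _ = B / L * |deriv ubar τ| := by ring
  have hincr : ∀ s t, 0 ≤ s → s ≤ t → t ≤ T → ∀ B : ℝ, (∀ τ ∈ Icc s t, |S τ - S t| ≤ B) →
      cohesiveGap L φ u γ s t
        + κ * stateDist L (u s) (shear ((ubar t - ubar s) / L) (u t)) (α s) (α t) ≤
      B / L * A s t + M / L * A s t ^ 2 := by
    intro s t hs hst ht B hB
    have h1 := h.cohesiveGap_add_le hL hE hM hstab hs hst ht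
    have h2 := hwork s t hs hst ht B hB
    have h3 : M * L * ((ubar t - ubar s) / L) ^ 2 ≤ M / L * A s t ^ 2 := by
      have h4 : (ubar t - ubar s) ^ 2 ≤ A s t ^ 2 := by
        rw [← sq_abs]
        exact pow_le_pow_left₀ (abs_nonneg _)
          (hΔA s ⟨hs, hst.trans ht⟩ t ⟨hs.trans hst, ht⟩ hst) 2
      calc M * L * ((ubar t - ubar s) / L) ^ 2 = M / L * (ubar t - ubar s) ^ 2 := by
            field_simp
        _ ≤ _ := by gcongr
    exact h1.trans (by linarith)
  -- the states depend continuously on time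
  have hdist : ∃ D : ℝ, 0 ≤ D ∧ ∀ s t, 0 ≤ s → s ≤ t → t ≤ T → A s t ≤ 1 →
      stateDist L (u s) (u t) (α s) (α t) ≤ D * A s t := by
    refine ⟨2 * ((2 * S₀ / L + M / L) / κ) + 4 / L, by positivity, fun s t hs hst ht hA1 => ?_⟩
    have hsT : s ∈ Icc 0 T := ⟨hs, hst.trans ht⟩
    have htT : t ∈ Icc 0 T := ⟨hs.trans hst, ht⟩
    -- First use of the increment estimate, with the crude oscillation bound `2 S₀` for the stress.
    -- Dropping the non-negative gap leaves a linear bound on the distance.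
    have h1 := hincr s t hs hst ht (2 * S₀) fun τ hτ => by
      have a1 := hSb τ ⟨hs.trans hτ.1, hτ.2.trans ht⟩
      have a2 := hSb t htT
      have := abs_sub (S τ) (S t)
      linarith
    have h2 := h.cohesiveGap_nonneg hL.le hφ hmono hs hst ht
    have h3 : A s t ^ 2 ≤ A s t := by
      have := hA0 s t hst
      nlinarith
    have h4 : κ * stateDist L (u s) (shear ((ubar t - ubar s) / L) (u t)) (α s) (α t) ≤
        (2 * S₀ / L + M / L) * A s t := by
      have : M / L * A s t ^ 2 ≤ M / L * A s t := by gcongr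
      linarith
    have h5 : stateDist L (u s) (shear ((ubar t - ubar s) / L) (u t)) (α s) (α t) ≤
        (2 * S₀ / L + M / L) / κ * A s t := by
      rw [div_mul_eq_mul_div, le_div_iff₀ hκ]
      linarith
    have h6 := stateDist_le_shear hL.le (α := α s) (β := α t) (hmem s hsT) (hmem t htT)
      ((ubar t - ubar s) / L)
    have h7 : 4 * L * ((ubar t - ubar s) / L) ^ 2 ≤ 4 / L * A s t := by
      have h8 : (ubar t - ubar s) ^ 2 ≤ A s t := by
        rw [← sq_abs]
        exact (pow_le_pow_left₀ (abs_nonneg _) (hΔA s hsT t htT hst) 2).trans h3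
      calc 4 * L * ((ubar t - ubar s) / L) ^ 2 = 4 / L * (ubar t - ubar s) ^ 2 := by
            field_simp
        _ ≤ _ := by gcongr
    linarith
  obtain ⟨D, hD0, hD⟩ := hdist
  set B₀ := 2 * (M * L + Λ * R) + (M + Λ) * D with hB₀
  have hB₀0 : 0 ≤ B₀ := by positivity
  refine ⟨B₀ / L + M / L, by positivity, fun η hη hη1 s t hs hst ht hAη => ?_⟩
  have hsT : s ∈ Icc 0 T := ⟨hs, hst.trans ht⟩
  have htT : t ∈ Icc 0 T := ⟨hs.trans hst, ht⟩
  have hη2 : η ^ 2 ≤ η := by nlinarith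
  -- Second use: the distance is now at most `D η²`, so the stress oscillates by only `B₀ η`, and
  -- the increment estimate improves by the factor `η`.
  have hB : ∀ τ ∈ Icc s t, |S τ - S t| ≤ B₀ * η := by
    intro τ hτ
    have hτT : τ ∈ Icc 0 T := ⟨hs.trans hτ.1, hτ.2.trans ht⟩
    have hAτ : A τ t ≤ η ^ 2 := (hAmono s τ t hs hτ.1 hτ.2 ht).trans hAη
    have h1 := hD τ t hτT.1 hτ.2 ht (hAτ.trans (hη2.trans hη1))
    have h2 := abs_totalStress_sub_le hL.le hE hM0.le hΛ0.le hM hΛ (hmem τ hτT) (hmem t htT)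
      (h.damage_mem τ hτT) (h.damage_mem t htT) (hR t htT) hη
    have h3 : stateDist L (u τ) (u t) (α τ) (α t) / η ≤ D * η := by
      rw [div_le_iff₀ hη]
      have := mul_le_mul_of_nonneg_left hAτ hD0
      nlinarith
    have h4 := mul_le_mul_of_nonneg_left h3 (by positivity : 0 ≤ M + Λ)
    refine h2.trans ?_
    rw [mul_div_assoc, hB₀]
    linarith
  have h1 := hincr s t hs hst ht _ hB
  have h2 : 0 ≤ κ * stateDist L (u s) (shear ((ubar t - ubar s) / L) (u t)) (α s) (α t) :=
    mul_nonneg hκ.le (stateDist_nonneg hL.le _ _ _ _)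
  have h3 : M / L * A s t ^ 2 ≤ M / L * (η * A s t) := by
    have := mul_le_mul_of_nonneg_right (hAη.trans hη2) (hA0 s t hst)
    gcongr
    linarith
  change cohesiveGap L φ u γ s t ≤ (B₀ / L + M / L) * η * A s t
  have : B₀ * η / L * A s t = B₀ / L * η * A s t := by ring
  linarith

end Evolution

/-! ### The history variable and the history slip -/

/-- Failure of the strict inequality means that either `b ≤ a`, or `d ≤ a` and both truncations
equal `d`. The theorem thus reduces to excluding a strict gap below the threshold. -/
lemma cap_eq_of_not_lt {d : EReal} {a b : ℝ} (hab : a ≤ b)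
    (h : ¬ (a : EReal) < min (b : EReal) d) : cap d a = cap d b := by
  have hab' : (a : EReal) ≤ b := EReal.coe_le_coe_iff.2 hab
  rw [lt_min_iff, not_and_or, not_lt, not_lt] at h
  rcases h with h | h
  · rw [le_antisymm hab (EReal.coe_le_coe_iff.1 h)]
  · rw [cap, cap, min_eq_right h, min_eq_right (h.trans hab')]

section Evolution

variable {T L : ℝ} {E w : Fin 2 → ℝ → ℝ} {φ : ℝ → ℝ → ℝ} {lam : ℝ} {ubar : ℝ → ℝ}
  {u₀ α₀ : Fin 2 → ℝ → ℝ} {u α : ℝ → Fin 2 → ℝ → ℝ} {γ : ℝ → ℝ → ℝ}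

lemma IsGeneralisedEnergeticEvolution.slip_le_history_of_le
    (h : IsGeneralisedEnergeticEvolution T L E w φ ubar u₀ α₀ u α γ) {τ t x : ℝ}
    (hτ : τ ∈ Icc 0 t) (ht : t ≤ T) (hx : x ∈ Icc 0 L) : slip (u τ) x ≤ γ t x :=
  (h.slip_le_history τ ⟨hτ.1, hτ.2.trans ht⟩ x hx).trans
    (h.history_mono τ t hτ.1 hτ.2 ht x hx)

lemma IsGeneralisedEnergeticEvolution.slip_le_historySlip
    (h : IsGeneralisedEnergeticEvolution T L E w φ ubar u₀ α₀ u α γ) {τ t x : ℝ}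
    (hτ : τ ∈ Icc 0 t) (ht : t ≤ T) (hx : x ∈ Icc 0 L) : slip (u τ) x ≤ historySlip u t x :=
  -- Boundedness by `γ t x` ensures that `sSup` is a true supremum and not its default value.
  le_csSup ⟨γ t x, by
    rintro _ ⟨σ, hσ, rfl⟩
    exact h.slip_le_history_of_le hσ ht hx⟩ (mem_image_of_mem _ hτ)

lemma IsGeneralisedEnergeticEvolution.historySlip_le
    (h : IsGeneralisedEnergeticEvolution T L E w φ ubar u₀ α₀ u α γ) {t x : ℝ}
    (ht : t ∈ Icc 0 T) (hx : x ∈ Icc 0 L) : historySlip u t x ≤ γ t x :=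
  csSup_le ⟨_, mem_image_of_mem _ (left_mem_Icc.2 ht.1)⟩ (by
    rintro _ ⟨σ, hσ, rfl⟩
    exact h.slip_le_history_of_le hσ ht.2 hx)

/-- The slip is continuous in space, uniformly in time. -/
lemma IsGeneralisedEnergeticEvolution.exists_slip_le
    (h : IsGeneralisedEnergeticEvolution T L E w φ ubar u₀ α₀ u α γ) (hL : 0 < L) {R : ℝ}
    (hR0 : 0 ≤ R) (hR : ∀ t ∈ Icc 0 T, ∀ i, ∫ x in (0 : ℝ)..L, weakDeriv L (u t i) x ^ 2 ≤ R)
    {ε : ℝ} (hε : 0 < ε) :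
    ∃ ρ : ℝ, 0 < ρ ∧ ∀ t ∈ Icc 0 T, ∀ x ∈ Icc 0 L, ∀ y ∈ Icc 0 L, |y - x| ≤ ρ →
      slip (u t) y ≤ slip (u t) x + ε := by
  -- Chosen so that `η R ≤ ε/4`, with `R + 1` guarding against `R = 0`; each layer then varies by at
  -- most `ε/2`.
  set η := ε / (4 * (R + 1)) with hη
  have hη0 : 0 < η := by positivity
  refine ⟨ε / 4 * η, by positivity, fun t ht x hx y hy hxy => ?_⟩
  have key : ∀ i, |u t i y - u t i x| ≤ ε / 2 := by
    intro i
    have h1 := (h.displacement_mem t ht i).1.hasH1Deriv.abs_sub_le hL (hR t ht i) hη0 hy hx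
    have h2 : |y - x| / η ≤ ε / 4 := by rwa [div_le_iff₀ hη0]
    have h3 : η * R ≤ ε / 4 := by
      have : η * (R + 1) = ε / 4 := by rw [hη]; field_simp
      nlinarith
    linarith
  have h0 := key 0
  have h1 := key 1
  have e : u t 0 y - u t 1 y = (u t 0 x - u t 1 x) + ((u t 0 y - u t 0 x) - (u t 1 y - u t 1 x)) := by
    ring
  simp only [slip]
  rw [e]
  have h2 := abs_add_le (u t 0 x - u t 1 x) ((u t 0 y - u t 0 x) - (u t 1 y - u t 1 x))
  have h3 := abs_sub (u t 0 y - u t 0 x) (u t 1 y - u t 1 x)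
  linarith

/-- The gap controls the growth of the truncated history variable wherever the slip is small. -/
lemma IsGeneralisedEnergeticEvolution.mul_integral_sub_le_cohesiveGap
    (h : IsGeneralisedEnergeticEvolution T L E w φ ubar u₀ α₀ u α γ)
    (hφ : DensityAssumption φ lam) (hmono : UniformStrictMono φ) {C y₀ b c p q : ℝ}
    (hyc : y₀ ≤ c)
    (hC : ∀ y z₁ z₂ : ℝ, 0 ≤ y → y ≤ y₀ → y ≤ z₁ → z₁ ≤ z₂ →
      C * (max c (min z₂ b) - max c (min z₁ b)) ≤ φ y z₂ - φ y z₁)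
    (hp : 0 ≤ p) (hpq : p ≤ q) (hq : q ≤ L) {s t : ℝ} (hs : 0 ≤ s) (hst : s ≤ t) (ht : t ≤ T)
    (hslip : ∀ x ∈ Icc p q, slip (u t) x ≤ y₀) :
    C * ((∫ x in p..q, max c (min (γ t x) b)) - ∫ x in p..q, max c (min (γ s x) b)) ≤
      cohesiveGap L φ u γ s t := by
  have hsT : s ∈ Icc 0 T := ⟨hs, hst.trans ht⟩
  have htT : t ∈ Icc 0 T := ⟨hs.trans hst, ht⟩
  have hL : 0 ≤ L := hp.trans (hpq.trans hq)
  have hsub : Icc p q ⊆ Icc 0 L := Icc_subset_Icc hp hq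
  have hi : ∀ τ ∈ Icc 0 T, IntervalIntegrable (fun x => max c (min (γ τ x) b)) volume p q :=
    fun τ hτ => ContinuousOn.intervalIntegrable_of_Icc hpq (continuousOn_const.sup
      (((h.history_continuous τ hτ).mono hsub).inf continuousOn_const))
  obtain ⟨i1, e1⟩ := h.cohesiveGap_eq hL hφ hsT htT
  have hnn : ∀ x ∈ Icc 0 L, 0 ≤ φ (slip (u t) x) (γ t x)
      - φ (slip (u t) x) (max (γ s x) (slip (u t) x)) := fun x hx =>
    sub_nonneg.2 (h.cohesive_integrand_le hφ hmono hs hst ht hx)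
  rw [e1]
  refine le_trans ?_ (intervalIntegral.integral_mono_interval hp hpq hq ?_ i1)
  · rw [← intervalIntegral.integral_sub (hi t htT) (hi s hsT),
      ← intervalIntegral.integral_const_mul]
    refine intervalIntegral.integral_mono_on hpq (((hi t htT).sub (hi s hsT)).const_mul _)
      (i1.mono_set (by rw [uIcc_of_le hpq, uIcc_of_le hL]; exact hsub)) fun x hx => ?_
    have h1 := hC (slip (u t) x) (max (γ s x) (slip (u t) x)) (γ t x) (abs_nonneg _)
      (hslip x hx) (le_max_right _ _) (max_le (h.history_mono s t hs hst ht x (hsub hx))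
        (h.slip_le_history t htT x (hsub hx)))
    -- The slip lies below the floor `c` of the truncation, so taking the maximum with it changes
    -- nothing.
    have h2 : max c (min (max (γ s x) (slip (u t) x)) b) = max c (min (γ s x) b) := by
      have : min (slip (u t) x) b ≤ c := (min_le_left _ _).trans ((hslip x hx).trans hyc)
      rw [min_max_distrib_right, max_comm (min (γ s x) b), ← max_assoc, max_eq_left this]
    rw [h2] at h1
    exact h1
  · rw [Filter.EventuallyLE, ae_restrict_iff' measurableSet_Ioc]
    exact Filter.Eventually.of_forall fun x hx => hnn x (Ioc_subset_Icc_self hx)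

/-- Whenever the rate of the cohesive gap is superlinear, the gaps along a fine partition of
`[0,t]` have arbitrarily small sum. -/
lemma exists_partition_sum_lt {T t C X : ℝ} (hT : 0 ≤ T) (ht : t ∈ Icc 0 T) {f : ℝ → ℝ}
    (hf : IntervalIntegrable f volume 0 T) {G : ℝ → ℝ → ℝ} (hC : 0 ≤ C)
    (hG : ∀ η : ℝ, 0 < η → η ≤ 1 → ∀ s t, 0 ≤ s → s ≤ t → t ≤ T →
      ∫ τ in s..t, |f τ| ≤ η ^ 2 → G s t ≤ C * η * ∫ τ in s..t, |f τ|) (hX : 0 < X) :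
    ∃ (n : ℕ) (σ : ℕ → ℝ), σ 0 = 0 ∧ σ n = t ∧ Monotone σ ∧ (∀ k ≤ n, σ k ≤ t) ∧
      ∑ k ∈ Finset.range n, G (σ k) (σ (k + 1)) < X := by
  set V := ∫ τ in (0 : ℝ)..t, |f τ| with hV
  have hV0 : 0 ≤ V := intervalIntegral.integral_nonneg ht.1 fun _ _ => abs_nonneg _
  have hW : 0 < C * V + 1 := by positivity
  -- This makes `C η V < X`; the `+ 1` covers `C V = 0` and gives the strict inequality.
  set η := min 1 (X / (C * V + 1)) with hη
  have hη0 : 0 < η := lt_min one_pos (by positivity)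
  have hi : ∀ a ∈ Icc 0 T, ∀ b ∈ Icc 0 T, IntervalIntegrable (fun τ => |f τ|) volume a b :=
    fun a ha b hb => hf.abs.mono_set (by rw [uIcc_of_le hT]; exact uIcc_subset_Icc ha hb)
  have h0T : (0 : ℝ) ∈ Icc 0 T := ⟨le_rfl, hT⟩
  -- Uniform continuity of `s ↦ ∫₀ˢ |f|` makes the integral over every cell of a fine equal
  -- subdivision at most `η²`.
  have huc := (hf.abs.absolutelyContinuousOnInterval_intervalIntegral
    (c := 0) left_mem_uIcc).uniformContinuousOn
  rw [Metric.uniformContinuousOn_iff] at huc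
  obtain ⟨d, hd, hdV⟩ := huc (η ^ 2) (by positivity)
  obtain ⟨n, hn⟩ := exists_nat_gt (t / d)
  have hn0 : (0 : ℝ) < n := (div_nonneg ht.1 hd.le).trans_lt hn
  set σ : ℕ → ℝ := fun k => t * (k / n) with hσ
  have hσmono : Monotone σ := by
    intro j k hjk
    have : (j : ℝ) ≤ k := Nat.cast_le.2 hjk
    have := ht.1
    simp only [hσ]
    gcongr
  have hσ0 : σ 0 = 0 := by simp [hσ]
  have hσn : σ n = t := by simp only [hσ]; rw [div_self hn0.ne', mul_one]
  have hσt : ∀ k ≤ n, σ k ≤ t := fun k hk => hσn ▸ hσmono hk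
  have hσT : ∀ k ≤ n, σ k ∈ Icc 0 T := fun k hk =>
    ⟨hσ0 ▸ hσmono (Nat.zero_le k), (hσt k hk).trans ht.2⟩
  refine ⟨n, σ, hσ0, hσn, hσmono, hσt, ?_⟩
  have hstep : ∀ k ∈ Finset.range n,
      G (σ k) (σ (k + 1)) ≤ C * η * ∫ τ in σ k..σ (k + 1), |f τ| := by
    intro k hk
    have hk1 : k + 1 ≤ n := Finset.mem_range.1 hk
    have hk0 : k ≤ n := (Nat.le_succ k).trans hk1
    refine hG η hη0 (min_le_left _ _) _ _ (hσT k hk0).1 (hσmono (Nat.le_succ k))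
      (hσT (k + 1) hk1).2 ?_
    have h1 := hdV (σ (k + 1)) (by rw [uIcc_of_le hT]; exact hσT _ hk1) (σ k)
      (by rw [uIcc_of_le hT]; exact hσT _ hk0) ?_
    · rw [Real.dist_eq, intervalIntegral.integral_interval_sub_left
        (hi 0 h0T _ (hσT _ hk1)) (hi 0 h0T _ (hσT _ hk0))] at h1
      exact (le_abs_self _).trans h1.le
    · have e : σ (k + 1) - σ k = t / n := by
        simp only [hσ]; push_cast; field_simp; ring
      rw [Real.dist_eq, e, abs_of_nonneg (div_nonneg ht.1 hn0.le), div_lt_iff₀ hn0]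
      rwa [div_lt_iff₀ hd, mul_comm] at hn
  refine (Finset.sum_le_sum hstep).trans_lt ?_
  rw [← Finset.mul_sum, intervalIntegral.sum_integral_adjacent_intervals fun k hk =>
    hi _ (hσT k hk.le) _ (hσT (k + 1) hk), hσ0, hσn]
  change C * η * V < X
  have h1 : η * (C * V + 1) ≤ X := by
    rw [← le_div_iff₀ hW]; exact min_le_right _ _
  nlinarith

/-- The history variable cannot exceed the history slip below the threshold `δ̄`. -/
lemma IsGeneralisedEnergeticEvolution.not_historySlip_lt
    (h : IsGeneralisedEnergeticEvolution T L E w φ ubar u₀ α₀ u α γ) (hT : 0 ≤ T) (hL : 0 < L)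
    (hlam : 0 < lam) (hE : ∀ i, ModulusAssumption (E i))
    (hw : ∀ i, DissipationAssumption (w i)) (hφ : DensityAssumption φ lam)
    (hmono : UniformStrictMono φ) {r : ℝ} (hr : lam * (L ^ 2 / Real.pi ^ 2) < r)
    (hrm : ∀ i, r < modulusm (E i) / modulusM (E i))
    (hubar : AbsolutelyContinuousOnInterval ubar 0 T) {t x : ℝ} (ht : t ∈ Icc 0 T)
    (hx : x ∈ Icc 0 L) : ¬ (historySlip u t x : EReal) < min (γ t x : EReal) (deltaBar φ) := by
  intro hlt
  obtain ⟨b, hab, hb⟩ := EReal.lt_iff_exists_real_btwn.1 hlt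
  rw [EReal.coe_lt_coe_iff] at hab
  rw [lt_min_iff, EReal.coe_lt_coe_iff] at hb
  set a := historySlip u t x with ha
  -- Three bands of width `ε` between `a` and `b`: the slip stays below `a + ε`, the truncation
  -- starts at `a + 2ε`, and it ends at `b`. The middle band separates the slip from the truncation
  -- and so keeps off the diagonal.
  set ε := (b - a) / 3 with hε
  have hε0 : 0 < ε := by rw [hε]; linarith
  have hr0 : 0 < r := lt_of_le_of_lt (by positivity) hr
  obtain ⟨R, hR0, hR⟩ := h.exists_bound hT hL.le hE hw hφ hr0 hrm
  obtain ⟨ρ₁, hρ₁, hslip⟩ := h.exists_slip_le hL hR0 hR hε0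
  obtain ⟨C₁, hC₁, hgrowth⟩ := hφ.exists_growth hmono (y₀ := a + ε) (c := a + 2 * ε) (b := b)
    (by linarith) (by linarith) hb.2.le
  have hnear : ∃ p q : ℝ, 0 ≤ p ∧ p < q ∧ q ≤ L ∧ ∀ y ∈ Icc p q, |y - x| ≤ ρ₁ ∧ b ≤ γ t y := by
    obtain ⟨ρ₂, hρ₂, hγ⟩ := Metric.continuousOn_iff.1 (h.history_continuous t ht) x hx
      (γ t x - b) (sub_pos.2 hb.1)
    set ρ := min ρ₁ (ρ₂ / 2)
    have hρ : 0 < ρ := lt_min hρ₁ (by linarith)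
    refine ⟨max 0 (x - ρ), min L (x + ρ), le_max_left _ _, ?_, min_le_left _ _,
      fun y hy => ?_⟩
    · refine max_lt (lt_min hL (by linarith [hx.1])) (lt_min (by linarith [hx.2]) (by linarith))
    · have hy0 : |y - x| ≤ ρ := by
        rw [abs_le]
        constructor
        · linarith [(le_max_right 0 (x - ρ)).trans hy.1]
        · linarith [hy.2.trans (min_le_right L (x + ρ))]
      refine ⟨hy0.trans (min_le_left _ _), ?_⟩
      have h1 := hγ y ⟨(le_max_left _ _).trans hy.1, hy.2.trans (min_le_left _ _)⟩ (by
        rw [Real.dist_eq]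
        have := min_le_right ρ₁ (ρ₂ / 2)
        linarith)
      rw [Real.dist_eq] at h1
      linarith [neg_abs_le (γ t y - γ t x)]
  obtain ⟨p, q, hp, hpq, hq, hpqy⟩ := hnear
  have hsub : Icc p q ⊆ Icc 0 L := Icc_subset_Icc hp hq
  -- One spatial interval serves all times `τ ≤ t`, because the `H¹` bound is uniform in time.
  have hsmall : ∀ τ ∈ Icc 0 t, ∀ y ∈ Icc p q, slip (u τ) y ≤ a + ε := fun τ hτ y hy =>
    (hslip τ ⟨hτ.1, hτ.2.trans ht.2⟩ x hx y (hsub hy) (hpqy y hy).1).trans (by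
      have := h.slip_le_historySlip hτ ht.2 hx
      linarith)
  obtain ⟨C, hC, hgap⟩ := h.exists_cohesiveGap_le hT hL hlam hE hw hφ hmono hr hrm hubar
  obtain ⟨n, σ, hσ0, hσn, hσmono, hσt, hsum⟩ := exists_partition_sum_lt hT ht
    hubar.intervalIntegrable_deriv hC hgap (X := C₁ * ((q - p) * ε))
    (mul_pos hC₁ (mul_pos (sub_pos.2 hpq) hε0))
  set I : ℕ → ℝ := fun k => ∫ y in p..q, max (a + 2 * ε) (min (γ (σ k) y) b) with hI
  have hpos : ∀ k, 0 ≤ σ k := fun k => hσ0 ▸ hσmono (Nat.zero_le k)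
  have hstep : ∀ k ∈ Finset.range n,
      C₁ * (I (k + 1) - I k) ≤ cohesiveGap L φ u γ (σ k) (σ (k + 1)) := by
    intro k hk
    have hk1 : σ (k + 1) ≤ t := hσt (k + 1) (Finset.mem_range.1 hk)
    exact h.mul_integral_sub_le_cohesiveGap hφ hmono (by linarith) hgrowth hp hpq.le hq (hpos k)
      (hσmono (Nat.le_succ k)) (hk1.trans ht.2) (hsmall _ ⟨hpos _, hk1⟩)
  -- The lower bounds telescope to `C₁ (I n - I 0)`. At time `t` the truncation is saturated at `b`;
  -- at time `0` the history equals the initial slip and sits on the floor. The difference is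
  -- exactly the amount `C₁ (q - p) ε` that the sum was made to stay below.
  have htel := (Finset.sum_le_sum hstep).trans_lt hsum
  rw [← Finset.mul_sum, Finset.sum_range_sub] at htel
  have hIn : I n = (q - p) * b := by
    have : I n = ∫ _ in p..q, b := by
      refine intervalIntegral.integral_congr fun y hy => ?_
      rw [uIcc_of_le hpq.le] at hy
      simp only [hσn]
      rw [min_eq_right (hpqy y hy).2, max_eq_right (by linarith)]
    rw [this, intervalIntegral.integral_const, smul_eq_mul]
  have hI0 : I 0 = (q - p) * (a + 2 * ε) := by
    have : I 0 = ∫ _ in p..q, (a + 2 * ε) := by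
      refine intervalIntegral.integral_congr fun y hy => ?_
      rw [uIcc_of_le hpq.le] at hy
      have h1 : γ 0 y ≤ a + ε := by
        have h2 := hsmall 0 ⟨le_rfl, ht.1⟩ y hy
        rw [h.history_init (hsub hy)]
        simp only [slip] at h2 ⊢
        rwa [← h.displacement_init 0 (hsub hy), ← h.displacement_init 1 (hsub hy)]
      simp only [hσ0]
      exact max_eq_left ((min_le_left _ _).trans (by linarith))
    rw [this, intervalIntegral.integral_const, smul_eq_mul]
  rw [hIn, hI0] at htel
  have : (q - p) * b - (q - p) * (a + 2 * ε) = (q - p) * ε := by rw [hε]; ring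
  rw [this] at htel
  exact lt_irrefl _ htel

end Evolution

end CohesiveLaminate

theorem mainTheorem2
    (T L : ℝ) (hT : 0 < T) (hL : 0 < L)
    (E w : Fin 2 → ℝ → ℝ) (φ : ℝ → ℝ → ℝ) (lam : ℝ) (hlam : 0 < lam)
    (hE : ∀ i, CohesiveLaminate.ModulusAssumption (E i))
    (hw : ∀ i, CohesiveLaminate.DissipationAssumption (w i))
    (hφ : CohesiveLaminate.DensityAssumption φ lam)
    (hmono : CohesiveLaminate.UniformStrictMono φ)
    (hparam : lam * (L ^ 2 / Real.pi ^ 2) <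
      min (CohesiveLaminate.modulusm (E 0) / CohesiveLaminate.modulusM (E 0))
        (CohesiveLaminate.modulusm (E 1) / CohesiveLaminate.modulusM (E 1)))
    (ubar : ℝ → ℝ) (hubar : AbsolutelyContinuousOnInterval ubar 0 T)
    (u₀ α₀ : Fin 2 → ℝ → ℝ) (hdata : CohesiveLaminate.CompatibleData L ubar u₀ α₀)
    (u α : ℝ → Fin 2 → ℝ → ℝ) (γ : ℝ → ℝ → ℝ)
    (hevol : CohesiveLaminate.IsGeneralisedEnergeticEvolution T L E w φ ubar u₀ α₀ u α γ)
    (hequi : EquicontinuousOn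
      (fun (t : Set.Icc (0 : ℝ) T) (x : ℝ) =>
        CohesiveLaminate.cap (CohesiveLaminate.deltaBar φ) (γ t x)) (Set.Icc 0 L)) :
    ∀ t ∈ Set.Icc 0 T, ∀ x ∈ Set.Icc 0 L,
      CohesiveLaminate.cap (CohesiveLaminate.deltaBar φ) (γ t x) =
        CohesiveLaminate.cap (CohesiveLaminate.deltaBar φ)
          (CohesiveLaminate.historySlip u t x) := by
  intro t ht x hx
  -- The strict inequality leaves room for `r`: the margin above `lam L²/π²` gives uniform
  -- convexity, the one below the ratios gives concave compliances.
  obtain ⟨r, hr, hrm⟩ := exists_between hparam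
  have hrm' : ∀ i, r < CohesiveLaminate.modulusm (E i) / CohesiveLaminate.modulusM (E i) := by
    intro i
    fin_cases i
    · exact (lt_min_iff.1 hrm).1
    · exact (lt_min_iff.1 hrm).2
  exact (CohesiveLaminate.cap_eq_of_not_lt (hevol.historySlip_le ht hx)
    (hevol.not_historySlip_lt hT.le hL hlam hE hw hφ hmono hr hrm' hubar ht hx)).symm
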